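/- Fix a set $\mathcal V$ of names. Let $\mathfrak S_f(\mathcal V)$ be the group of finite permutations of $\mathcal V$, i.e. those moving only finitely many names. For $W\subseteq\mathcal V$ let $m_W:\mathfrak S_f(W)\hookrightarrow\mathfrak S_f(\mathcal V)$ be the inclusion of the subgroup of finite permutations that fix every name outside $W$. A nominal set is a set with a left action of $\mathfrak S_f(\mathcal V)$ in which every element $x$ has a finite support, i.e. there is a finite set $A\subseteq\mathcal V$ such that every $\pi\in\mathfrak S_f(\mathcal V)$ fixing all names in $A$ satisfies $\pi\cdot x=x$. Let $\mathbf{Nom}$ be the category of nominal sets and equivariant maps, a full subcategory of the category of $\mathfrak S_f(\mathcal V)$-sets. For a finitary endofunctor $H$ of $\mathbf{Set}$ or of $\mathbf{Nom}$, the rational fixpoint $(\varrho H,r)$ of $H$ is the colimit, in the category $\mathrm{Coalg}\,H$ of all $H$-coalgebras, of the inclusion of the full subcategory of $H$-coalgebras with finitely presentable carrier. Let $F:\mathbf{Set}\to\mathbf{Set}$ be a functor that is finitary (preserves filtered colimits) and preserves monomorphisms, and let $\lambda:\mathfrak S_f(\mathcal V)\times F(-)\to F(\mathfrak S_f(\mathcal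 V)\times(-))$ be a distributive law of the monad $\mathfrak S_f(\mathcal V)\times(-)$ over $F$. Assume that 1. $\lambda$ is localizable: for every $W\subseteq\mathcal V$ there is a natural transformation $\lambda^W:\mathfrak S_f(W)\times F(-)\to F(\mathfrak S_f(W)\times(-))$ such that $\lambda_X\cdot(m_W\times\mathrm{id}_{FX})=F(m_W\times\mathrm{id}_X)\cdot\lambda^W_X$ for every set $X$; 2. $\lambda$ is $\mathbf{Nom}$-restricting: the induced lifting $\hat F$ of $F$ to $\mathfrak S_f(\mathcal V)$-sets, which sends a set $A$ with action $\alpha:\mathfrak S_f(\mathcal V)\times A\to A$ to $FA$ with action $F\alpha\cdot\lambda_A$, preserves nominal sets. Let $\bar F:\mathbf{Nom}\to\mathbf{Nom}$ be the restriction of $\hat F$ (the localizable lifting of $F$ induced by $\lambda$). Then $\bar F$ is finitary and $F$ has a rational fixpoint. Moreover, for the rational fixpoint $(\varrho F,r)$ of $F$ in $\mathbf{Set}$ there is a unique $F$-coalgebra homomorphism $a$ from the coalgebra $$\mathfrak S_f(\mathcal V)\times\varrho F\xrightarrow{\ \mathrm{id}\times r\ }\mathfrak S_f(\mathcal V)\times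 F(\varrho F)\xrightarrow{\ \lambda_{\varrho F}\ }F(\mathfrak S_f(\mathcal V)\times\varrho F)$$ to $(\varrho F,r)$. This map $a:\mathfrak S_f(\mathcal V)\times\varrho F\to\varrho F$ is a group action that makes $\varrho F$ a nominal set and $r:\varrho F\to\bar F(\varrho F)$ an equivariant map, and the resulting $\bar F$-coalgebra $(\varrho F,r)$ is the rational fixpoint of $\bar F$ in $\mathbf{Nom}$. -/

import Mathlib

open CategoryTheory Limits

universe w u

namespace NominalLifting

/-! ### Finite permutations and nominal sets -/

/-- The group of finite permutations of `V`: those moving only finitely many names. -/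
def FinPerm (V : Type u) : Subgroup (Equiv.Perm V) where
  carrier := {π | {v | π v ≠ v}.Finite}
  one_mem' := by simp
  mul_mem' := by
    intro π σ hπ hσ
    refine (hπ.union hσ).subset ?_
    intro v hv
    by_contra h
    simp only [Set.mem_union, Set.mem_ofPred_eq, not_or, not_not] at h
    exact hv (by rw [Equiv.Perm.mul_apply, h.2, h.1])
  inv_mem' := by
    intro π hπ
    refine hπ.subset ?_
    intro v hv h
    exact hv (by rw [Equiv.Perm.inv_eq_iff_eq, h])

/-- The group of finite permutations of a subset `W` of `V`, regarded as a subgroup of the group of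
finite permutations of `V`: those fixing every name outside `W`. -/
def FinPermOn {V : Type u} (W : Set V) : Subgroup (FinPerm V) where
  carrier := {π | ∀ v, v ∉ W → (π : Equiv.Perm V) v = v}
  one_mem' := by simp
  mul_mem' := by
    intro π σ hπ hσ v hv
    rw [Subgroup.coe_mul, Equiv.Perm.mul_apply, hσ v hv, hπ v hv]
  inv_mem' := by
    intro π hπ v hv
    rw [Subgroup.coe_inv, Equiv.Perm.inv_eq_iff_eq, hπ v hv]

/-- The category of sets with a left action of the group of finite permutations of `V`, and
equivariant maps. -/
abbrev PermSet (V : Type u) : Type (u + 1) := Action (Type u) (FinPerm V)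

/-- A set `A` of names supports `x` if every finite permutation fixing all names in `A`
fixes `x`. -/
def Supports {V : Type u} {X : PermSet V} (A : Set V) (x : X.V) : Prop :=
  ∀ π : FinPerm V, (∀ a ∈ A, (π : Equiv.Perm V) a = a) → X.ρ π x = x

/-- A set with an action of the finite permutations is nominal if all its elements are finitely
supported. -/
def isNominal (V : Type u) : ObjectProperty (PermSet V) :=
  fun X => ∀ x : X.V, ∃ A : Set V, A.Finite ∧ Supports A x

/-- The category of nominal sets and equivariant maps. -/
abbrev Nom (V : Type u) : Type (u + 1) := (isNominal V).FullSubcategory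

/-! ### The rational fixpoint -/

section RationalFixpoint

variable {C : Type w} [Category.{u} C]

/-- The coalgebras whose carrier is a finitely presentable object. -/
def fpCoalgebra (F : C ⥤ C) : ObjectProperty (Endofunctor.Coalgebra F) :=
  fun A => IsFinitelyPresentable.{u} A.V

/-- A coalgebra is the rational fixpoint of `F` if it is the colimit, in the category of all
coalgebras, of the inclusion of the full subcategory of coalgebras with finitely presentable
carrier. -/
def IsRationalFixpoint (F : C ⥤ C) (R : Endofunctor.Coalgebra F) : Prop :=
  ∃ s : (fpCoalgebra F).ι ⟶ (Functor.const (fpCoalgebra F).FullSubcategory).obj R,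
    Nonempty (IsColimit (Cocone.mk R s))

/-- A distributive law of the monad `T` over the functor `F`. -/
structure DistributiveLaw (T : Monad C) (F : C ⥤ C) where
  /-- The underlying natural transformation `TF ⟶ FT`. -/
  trans : F ⋙ T.toFunctor ⟶ T.toFunctor ⋙ F
  unit : ∀ X : C, T.η.app (F.obj X) ≫ trans.app X = F.map (T.η.app X)
  mult : ∀ X : C, T.μ.app (F.obj X) ≫ trans.app X =
    T.map (trans.app X) ≫ trans.app (T.obj X) ≫ F.map (T.μ.app X)

end RationalFixpoint

/-! ### The monad `M × (-)` and localizable distributive laws -/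

/-- The functor `M × (-)` on sets. -/
def prodFunctor (M : Type u) : Type u ⥤ Type u where
  obj X := M × X
  map f := ↾(fun p => (p.1, f p.2))

/-- The natural transformation `M × (-) ⟶ N × (-)` given by a map `M → N`. -/
def prodTrans {M N : Type u} (f : M → N) : prodFunctor M ⟶ prodFunctor N where
  app X := ↾(fun p => (f p.1, p.2))

/-- The monad `M × (-)` on sets, for a monoid `M`. -/
def actionMonad (M : Type u) [Monoid M] : Monad (Type u) where
  toFunctor := prodFunctor M
  η := { app := fun X => ↾(fun x => ((1 : M), x)) }
  μ := { app := fun X => ↾(fun p => (p.1 * p.2.1, p.2.2)) }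
  assoc X := by
    ext p
    exact Prod.ext (mul_assoc p.1 p.2.1 p.2.2.1).symm rfl
  left_unit X := by
    ext p
    exact Prod.ext (one_mul p.1) rfl
  right_unit X := by
    ext p
    exact Prod.ext (mul_one p.1) rfl

/-- Distributive laws of the monad `FinPerm V × (-)` over the functor `F`. -/
abbrev PermLaw (V : Type u) (F : Type u ⥤ Type u) : Type (u + 1) :=
  DistributiveLaw (actionMonad (FinPerm V)) F

namespace PermLaw

variable {V : Type u} {F : Type u ⥤ Type u} (lam : PermLaw V F)

/-- The component `FinPerm V × F X ⟶ F (FinPerm V × X)` of a distributive law. -/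
def app (X : Type u) : (FinPerm V × F.obj X : Type u) ⟶ F.obj (FinPerm V × X) :=
  lam.trans.app X

lemma app_one (X : Type u) (x : F.obj X) :
    lam.app X (1, x) = F.map (↾(fun y : X => ((1 : FinPerm V), y))) x :=
  ConcreteCategory.congr_hom (lam.unit X) x

lemma app_mul (X : Type u) (π σ : FinPerm V) (x : F.obj X) :
    lam.app X (π * σ, x) =
      F.map (↾(fun p : FinPerm V × (FinPerm V × X) => (p.1 * p.2.1, p.2.2)))
        (lam.app (FinPerm V × X) (π, lam.app X (σ, x))) :=
  ConcreteCategory.congr_hom (lam.mult X) ((π, (σ, x)) : FinPerm V × FinPerm V × F.obj X)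

lemma app_natural {X Y : Type u} (f : X ⟶ Y) (π : FinPerm V) (x : F.obj X) :
    lam.app Y (π, F.map f x) =
      F.map (↾(fun p : FinPerm V × X => (p.1, f p.2))) (lam.app X (π, x)) :=
  ConcreteCategory.congr_hom (lam.trans.naturality f) ((π, x) : FinPerm V × F.obj X)

/-- A distributive law is localizable if, for every set `W` of names, it restricts to a natural
transformation `FinPermOn W × F (-) ⟶ F (FinPermOn W × (-))`. -/
def Localizable : Prop :=
  ∀ W : Set V, ∃ lamW : F ⋙ prodFunctor (FinPermOn W) ⟶ prodFunctor (FinPermOn W) ⋙ F,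
    ∀ X : Type u, (prodTrans (FinPermOn W).subtype).app (F.obj X) ≫ lam.app X =
      lamW.app X ≫ F.map ((prodTrans (FinPermOn W).subtype).app X)

end PermLaw

/-! ### The liftings induced by a distributive law -/

/-- The action of an object of `PermSet V`, as a map `FinPerm V × A ⟶ A`. -/
def actMap {V : Type u} (A : PermSet V) : (FinPerm V × A.V : Type u) ⟶ A.V :=
  ↾(fun p => A.ρ p.1 p.2)

namespace PermLaw

variable {V : Type u} {F : Type u ⥤ Type u} (lam : PermLaw V F)

lemma map_map_apply (F : Type u ⥤ Type u) {X Y Z : Type u} (f : X ⟶ Y) (g : Y ⟶ Z)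
    (x : F.obj X) : F.map g (F.map f x) = F.map (f ≫ g) x := by
  rw [F.map_comp]
  rfl

/-- The action on `F A` induced by the distributive law: it sends `(π, x)` to `F a (lam (π, x))`,
where `a` is the action of `A`. -/
def liftAct (A : PermSet V) (π : FinPerm V) (x : F.obj A.V) : F.obj A.V :=
  F.map (actMap A) (lam.app A.V (π, x))

lemma liftAct_one (A : PermSet V) (x : F.obj A.V) : lam.liftAct A 1 x = x := by
  have h : (↾(fun y : A.V => ((1 : FinPerm V), y))) ≫ actMap A = 𝟙 A.V := by
    ext a
    change A.ρ 1 a = a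
    rw [map_one]
    rfl
  rw [liftAct, app_one, map_map_apply, h, F.map_id]
  rfl

lemma liftAct_mul (A : PermSet V) (π σ : FinPerm V) (x : F.obj A.V) :
    lam.liftAct A (π * σ) x = lam.liftAct A π (lam.liftAct A σ x) := by
  have h : (↾(fun p : FinPerm V × (FinPerm V × A.V) => (p.1 * p.2.1, p.2.2))) ≫ actMap A =
      (↾(fun p : FinPerm V × (FinPerm V × A.V) => (p.1, actMap A p.2))) ≫ actMap A := by
    ext p
    change A.ρ (p.1 * p.2.1) p.2.2 = A.ρ p.1 (A.ρ p.2.1 p.2.2)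
    rw [map_mul]
    rfl
  rw [liftAct, liftAct, liftAct, app_mul, app_natural, map_map_apply, map_map_apply, h]

lemma liftAct_natural {A B : PermSet V} (f : A ⟶ B) (π : FinPerm V) (x : F.obj A.V) :
    F.map f.hom (lam.liftAct A π x) = lam.liftAct B π (F.map f.hom x) := by
  have h : actMap A ≫ f.hom =
      (↾(fun p : FinPerm V × A.V => (p.1, f.hom p.2))) ≫ actMap B := by
    ext p
    exact ConcreteCategory.congr_hom (f.comm p.1) p.2
  rw [liftAct, liftAct, app_natural, map_map_apply, map_map_apply, h]

/-- The object part of the lifting of `F` to `PermSet V` induced by a distributive law. -/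
def liftObj (A : PermSet V) : PermSet V where
  V := F.obj A.V
  ρ :=
    { toFun := fun π => ↾(lam.liftAct A π)
      map_one' := ConcreteCategory.hom_ext _ _ (lam.liftAct_one A)
      map_mul' := fun π σ => ConcreteCategory.hom_ext _ _ (lam.liftAct_mul A π σ) }

/-- The lifting of `F` to `PermSet V` induced by a distributive law. -/
def permLift : PermSet V ⥤ PermSet V where
  obj A := lam.liftObj A
  map f :=
    { hom := F.map f.hom
      comm := fun π => ConcreteCategory.hom_ext _ _ (lam.liftAct_natural f π) }
  map_id A := Action.Hom.ext (F.map_id A.V)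
  map_comp f g := Action.Hom.ext (F.map_comp f.hom g.hom)

/-- A distributive law is `Nom`-restricting if the induced lifting to `PermSet V` preserves nominal
sets. -/
def NomRestricting : Prop :=
  ∀ A : PermSet V, isNominal V A → isNominal V (lam.permLift.obj A)

/-- The lifting of `F` to nominal sets induced by a `Nom`-restricting distributive law. -/
def nomLift (h : lam.NomRestricting) : Nom V ⥤ Nom V :=
  (isNominal V).lift ((isNominal V).ι ⋙ lam.permLift) (fun A => h A.obj A.property)

/-! ### The lifted coalgebra -/

/-- For an `F`-coalgebra `(R, r)`, the `F`-coalgebra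
`FinPerm V × R ⟶ FinPerm V × F R ⟶ F (FinPerm V × R)`. -/
def prodCoalgebra (R : Endofunctor.Coalgebra F) : Endofunctor.Coalgebra F where
  V := FinPerm V × R.V
  str := ↾(fun p => (p.1, R.str p.2)) ≫ lam.app R.V

/-- Given an action `ρ` on the carrier of an `F`-coalgebra `(R, r)` that makes it a nominal set and
`r` an equivariant map, the resulting coalgebra for the lifting of `F` to nominal sets. -/
def liftCoalgebra (h : lam.NomRestricting) (R : Endofunctor.Coalgebra F)
    (ρ : FinPerm V →* End R.V) (hnom : isNominal V (Action.mk R.V ρ))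
    (hequiv : ∀ π : FinPerm V,
      ρ π ≫ R.str = R.str ≫ (lam.permLift.obj (Action.mk R.V ρ)).ρ π) :
    Endofunctor.Coalgebra (lam.nomLift h) where
  V := ⟨Action.mk R.V ρ, hnom⟩
  str := ObjectProperty.homMk
    { hom := R.str
      comm := hequiv }

end PermLaw

end NominalLifting

/-! Since `F` preserves monomorphisms, homomorphisms corestrict to subcoalgebras. Hence the rational
fixpoint in sets is characterized as a locally finite coalgebra that receives exactly one
homomorphism from each finite coalgebra (`IsRationalFixpoint.of_locallyFinite`,
`IsRationalFixpoint.locallyFinite`, `IsRationalFixpoint.existsUnique_hom_of_finite`). One exists: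
identify as much as possible in the sum of all finite coalgebras. By gluing, it receives exactly one
homomorphism from every locally finite coalgebra.

Localizability replaces the infinite group by the finite groups `FinPermOn W`, `W` finite: if `C` is
a finite coalgebra, so is `FinPermOn W × C`, and these cover `FinPerm V × C`. Thus `prodCoalgebra`
preserves local finiteness, which yields the unique `a`; the action laws compare homomorphisms out
of locally finite coalgebras. For finite supports, a finite `C` is given the trivial action. The
lifting of this nominal set is nominal, so finitely many names support all values of the structure
map. A permutation `π` fixing them acts trivially on the image of `C`, because the projection
`FinPermOn W × C → C`, with `W` the names moved by `π`, is then a homomorphism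
(`action_finitely_supported`).

In nominal sets, finitely presentable means having finitely many orbits. A coalgebra for the lifting
with such a carrier is locally finite in sets (`IsFinitelyGenerated.locallyFinite`), so it has a
unique homomorphism to the rational fixpoint, which is equivariant, again by uniqueness. Conversely,
the orbits of the image of a finite coalgebra form an orbit-finite subcoalgebra. These cover the
fixpoint, and the gluing argument used in sets shows that it is the colimit
(`isRationalFixpoint_liftCoalgebra`). -/

namespace NominalLifting

/-! ### Gluing morphisms along a directed cover -/

section Gluing

universe v₁ u₁

variable {D : Type u₁} [Category.{v₁} D]

/-- The object `L` is covered, through the faithful functor `U` to sets, by a directed family of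
morphisms from objects satisfying `P`, and maps out of `L` are morphisms as soon as they are so on
this cover. -/
structure IsCovered (P : ObjectProperty D) (U : D ⥤ Type u) (L : D) : Prop where
  cover : ∀ x : U.obj L, ∃ (C : D) (_ : P C) (f : C ⟶ L), x ∈ Set.range (U.map f)
  directed : ∀ {C C' : D} (_ : P C) (_ : P C') (f : C ⟶ L) (f' : C' ⟶ L),
    ∃ (B : D) (_ : P B) (m : B ⟶ L) (g : C ⟶ B) (g' : C' ⟶ B),
      Function.Injective (U.map m) ∧ g ≫ m = f ∧ g' ≫ m = f'
  glue : ∀ {E : D} (h : U.obj L ⟶ U.obj E),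
    (∀ {C : D} (_ : P C) (f : C ⟶ L), ∃ k : C ⟶ E, U.map f ≫ h = U.map k) →
      ∃ k : L ⟶ E, U.map k = h

variable {P : ObjectProperty D} {U : D ⥤ Type u} [U.Faithful] {L : D}

lemma IsCovered.hom_ext (hL : IsCovered P U L) {E : D} {h k : L ⟶ E}
    (w : ∀ {C : D} (_ : P C) (f : C ⟶ L), f ≫ h = f ≫ k) : h = k := by
  apply U.map_injective
  ext x
  obtain ⟨C, hC, f, y, rfl⟩ := hL.cover x
  have := ConcreteCategory.congr_hom (congrArg U.map (w hC f)) y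
  simpa using this

/-- A point of `L` is sent where `τ` sends any of its preimages in the cover; directedness makes
this independent of the preimage. -/
lemma IsCovered.exists_hom (hL : IsCovered P U L) {E : D}
    (τ : ∀ {C : D} (_ : P C) (_ : C ⟶ L), C ⟶ E)
    (nat : ∀ {C B : D} (hC : P C) (hB : P B) (g : C ⟶ B) (f : B ⟶ L),
      τ hC (g ≫ f) = g ≫ τ hB f) :
    ∃ h : L ⟶ E, ∀ {C : D} (hC : P C) (f : C ⟶ L), f ≫ h = τ hC f := by
  choose C hC f y hy using hL.cover
  let h : U.obj L ⟶ U.obj E := ↾(fun x => U.map (τ (hC x) (f x)) (y x))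
  have key : ∀ {B : D} (hB : P B) (g : B ⟶ L), U.map g ≫ h = U.map (τ hB g) := by
    intro B hB g
    ext b
    change U.map (τ (hC _) (f (U.map g b))) (y (U.map g b)) = U.map (τ hB g) b
    generalize hx : U.map g b = x
    -- Both representatives of `x` are moved into one `B'`, where injectivity of `m` makes them
    -- equal.
    obtain ⟨B', hB', m, k, k', hm, e, e'⟩ := hL.directed (hC x) hB (f x) g
    have hk : U.map k (y x) = U.map k' b := by
      apply hm
      have h1 := hy x
      have h2 := hx
      rw [← e, U.map_comp] at h1
      rw [← e', U.map_comp] at h2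
      exact h1.trans h2.symm
    rw [← e, ← e', nat _ hB', nat _ hB', U.map_comp, U.map_comp]
    exact congrArg (U.map (τ hB' m)) hk
  obtain ⟨k, hk⟩ := hL.glue h (fun hC f => ⟨_, key hC f⟩)
  refine ⟨k, fun hC f => U.map_injective ?_⟩
  rw [U.map_comp, hk, key]

lemma IsCovered.existsUnique_hom (hL : IsCovered P U L) {R : D}
    (hR : ∀ {C : D} (_ : P C), ∃! _f : C ⟶ R, True) : ∃! _f : L ⟶ R, True := by
  obtain ⟨h, -⟩ := hL.exists_hom (E := R) (fun hC _ => (hR hC).choose)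
    (fun hC _ _ _ => (hR hC).unique trivial trivial)
  exact ⟨h, trivial, fun k _ => hL.hom_ext fun hC _ => (hR hC).unique trivial trivial⟩

/-- Uniqueness of morphisms into `L` makes the cocone exist, and forces every covering morphism to
be one of its legs; a competing cocone is then a compatible family `τ` to be glued. -/
lemma IsCovered.exists_isColimit (hL : IsCovered P U L)
    (hu : ∀ {C : D} (_ : P C), ∃! _f : C ⟶ L, True) :
    ∃ s : P.ι ⟶ (Functor.const P.FullSubcategory).obj L, Nonempty (IsColimit (Cocone.mk L s)) := by
  refine ⟨{ app := fun C => (hu C.property).choose,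
            naturality := fun C B g => (hu C.property).unique trivial trivial }, ⟨?_⟩⟩
  have ex : ∀ t : Cocone P.ι, ∃ h : L ⟶ t.pt,
      ∀ {C : D} (hC : P C) (f : C ⟶ L), f ≫ h = t.ι.app ⟨C, hC⟩ := fun t =>
    hL.exists_hom (fun hC _ => t.ι.app ⟨_, hC⟩)
      (fun {C B} hC hB g _ => (t.w (j := ⟨B, hB⟩) (j' := ⟨C, hC⟩) (ObjectProperty.homMk g)).symm)
  choose d hd using ex
  exact
    { desc := d
      fac := fun t C => hd t C.property _
      uniq := fun t m hm => hL.hom_ext fun {C} hC f => by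
        rw [hd t hC f, ← hm ⟨C, hC⟩]
        congr 1
        exact (hu hC).unique trivial trivial }

end Gluing

/-! ### Coalgebras in the category of sets -/

section Coalgebra

variable {F : Type u ⥤ Type u}

/-- The inclusion of a subset. -/
abbrev incl {X : Type u} (S : Set X) : (S : Type u) ⟶ X := ↾(Subtype.val)

lemma map_injective (F : Type u ⥤ Type u) [F.PreservesMonomorphisms] {X Y : Type u} (f : X ⟶ Y)
    (hf : Function.Injective f) : Function.Injective (F.map f) := by
  have : Mono f := (mono_iff_injective f).2 hf
  exact (mono_iff_injective _).1 (inferInstanceAs (Mono (F.map f)))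

lemma map_apply_comp (F : Type u ⥤ Type u) {X Y Z : Type u} (f : X ⟶ Y) (g : Y ⟶ Z)
    (x : F.obj X) : F.map (f ≫ g) x = F.map g (F.map f x) :=
  (PermLaw.map_map_apply F f g x).symm

lemma isFinitelyPresentable_type_iff (X : Type u) : IsFinitelyPresentable.{u} X ↔ Finite X := by
  have := Cardinal.fact_isRegular_aleph0.{u}
  rw [IsFinitelyPresentable, Types.isCardinalPresentable_iff, hasCardinalLT_aleph0_iff]

/-- A set is the filtered colimit of its finite subsets, and `F` preserves this colimit. -/
lemma exists_finite_mem_range_map (F : Type u ⥤ Type u) [PreservesFilteredColimits F] {X : Type u}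
    (z : F.obj X) : ∃ S : Set X, S.Finite ∧ z ∈ Set.range (F.map (incl S)) := by
  have := Cardinal.fact_isRegular_aleph0.{u}
  have := HasCardinalLT.Set.isFiltered_of_aleph0_le X Cardinal.aleph0 le_rfl
  obtain ⟨S, y, hy⟩ := Types.jointly_surjective_of_isColimit
    (isColimitOfPreserves F (HasCardinalLT.Set.isColimitCocone X Cardinal.aleph0 le_rfl)) z
  exact ⟨S.1, Set.finite_coe_iff.1 ((hasCardinalLT_aleph0_iff _).1 S.2), y, hy⟩

lemma hom_congr {A B : Endofunctor.Coalgebra F} {f g : A ⟶ B} (h : f = g) (x : A.V) :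
    f.f x = g.f x := by rw [h]

lemma str_apply {A B : Endofunctor.Coalgebra F} (f : A ⟶ B) (x : A.V) :
    B.str (f.f x) = F.map f.f (A.str x) :=
  (ConcreteCategory.congr_hom f.h x).symm

/-- A map commuting elementwise with the structure maps is a coalgebra homomorphism. -/
def coalgebraHomMk {A B : Endofunctor.Coalgebra F} (f : A.V ⟶ B.V)
    (h : ∀ x, B.str (f x) = F.map f (A.str x)) : A ⟶ B :=
  Endofunctor.Coalgebra.Hom.mk f (ConcreteCategory.hom_ext _ _ fun x => (h x).symm)

/-- A subset is closed if the structure map restricts to it. -/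
def IsClosedUnder (R : Endofunctor.Coalgebra F) (I : Set R.V) : Prop :=
  ∀ x ∈ I, R.str x ∈ Set.range (F.map (incl I))

lemma range_map_mono (F : Type u ⥤ Type u) {X Y : Type u} {f : Y ⟶ X} {J : Set X}
    (hIJ : Set.range f ⊆ J) {z : F.obj X} (hz : z ∈ Set.range (F.map f)) :
    z ∈ Set.range (F.map (incl J)) := by
  obtain ⟨y, rfl⟩ := hz
  refine ⟨F.map (↾(fun i => (⟨f i, hIJ ⟨i, rfl⟩⟩ : J))) y, ?_⟩
  rw [← map_apply_comp]
  rfl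

lemma isClosedUnder_of_cover {R : Endofunctor.Coalgebra F} {I : Set R.V}
    (h : ∀ x ∈ I, ∃ (A : Endofunctor.Coalgebra F) (f : A ⟶ R),
      x ∈ Set.range f.f ∧ Set.range f.f ⊆ I) : IsClosedUnder R I := by
  intro x hx
  obtain ⟨A, f, ⟨y, rfl⟩, hI⟩ := h x hx
  rw [str_apply]
  exact range_map_mono F hI ⟨_, rfl⟩

/-- The subcoalgebra carried by a closed subset. -/
noncomputable def subcoalgebra (R : Endofunctor.Coalgebra F) (I : Set R.V)
    (h : IsClosedUnder R I) : Endofunctor.Coalgebra F where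
  V := I
  str := ↾(fun x => (h x.1 x.2).choose)

/-- The inclusion of a subcoalgebra. -/
noncomputable def subcoalgebraι (R : Endofunctor.Coalgebra F) (I : Set R.V)
    (h : IsClosedUnder R I) : subcoalgebra R I h ⟶ R :=
  coalgebraHomMk (incl I) (fun x => (h x.1 x.2).choose_spec.symm)

lemma fpCoalgebra_iff (C : Endofunctor.Coalgebra F) : fpCoalgebra F C ↔ Finite C.V :=
  isFinitelyPresentable_type_iff C.V

/-- A coalgebra is locally finite if it is covered by homomorphisms from finite coalgebras. -/
def LocallyFinite (L : Endofunctor.Coalgebra F) : Prop :=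
  ∀ x : L.V, ∃ (C : Endofunctor.Coalgebra F) (_ : Finite C.V) (f : C ⟶ L), x ∈ Set.range f.f

variable [F.PreservesMonomorphisms]

/-- A map whose composite with an injective homomorphism is a homomorphism is one itself. -/
def homOfComp {A B R : Endofunctor.Coalgebra F} (m : B ⟶ R) (hm : Function.Injective m.f)
    (f : A ⟶ R) (g : A.V ⟶ B.V) (hg : ∀ x, m.f (g x) = f.f x) : A ⟶ B :=
  coalgebraHomMk g fun x => by
    apply map_injective F m.f hm
    rw [← str_apply, hg, str_apply, ← map_apply_comp]
    have e : f.f = g ≫ m.f := by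
      ext y
      exact (hg y).symm
    rw [e]

/-- A homomorphism with values in a closed subset factors through the subcoalgebra. -/
noncomputable def subcoalgebraLift {A R : Endofunctor.Coalgebra F} {I : Set R.V}
    (h : IsClosedUnder R I) (f : A ⟶ R) (hf : ∀ x, f.f x ∈ I) : A ⟶ subcoalgebra R I h :=
  homOfComp (subcoalgebraι R I h) Subtype.val_injective f (↾(fun x => (⟨f.f x, hf x⟩ : I)))
    (fun _ => rfl)

lemma subcoalgebraLift_ι {A R : Endofunctor.Coalgebra F} {I : Set R.V}
    (h : IsClosedUnder R I) (f : A ⟶ R) (hf : ∀ x, f.f x ∈ I) :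
    subcoalgebraLift h f hf ≫ subcoalgebraι R I h = f := rfl

instance forget_faithful {C : Type w} [Category.{u} C] (H : C ⥤ C) :
    (Endofunctor.Coalgebra.forget H).Faithful where
  map_injective h := Endofunctor.Coalgebra.ext h

/-- Directedness holds because the union of two finite images is a finite closed subset, through
whose subcoalgebra both homomorphisms factor. -/
lemma LocallyFinite.isCovered {L : Endofunctor.Coalgebra F} (hL : LocallyFinite L) :
    IsCovered (fpCoalgebra F) (Endofunctor.Coalgebra.forget F) L where
  cover x := by
    obtain ⟨C, hC, f, hf⟩ := hL x
    exact ⟨C, (fpCoalgebra_iff C).2 hC, f, hf⟩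
  directed {C C'} hC hC' f f' := by
    rw [fpCoalgebra_iff] at hC hC'
    have hI : IsClosedUnder L (Set.range f.f ∪ Set.range f'.f) := by
      refine isClosedUnder_of_cover ?_
      rintro x (hx | hx)
      · exact ⟨C, f, hx, Set.subset_union_left⟩
      · exact ⟨C', f', hx, Set.subset_union_right⟩
    refine ⟨subcoalgebra L _ hI, ?_, subcoalgebraι L _ hI,
      subcoalgebraLift hI f (fun x => Or.inl ⟨x, rfl⟩),
      subcoalgebraLift hI f' (fun x => Or.inr ⟨x, rfl⟩), Subtype.val_injective,
      subcoalgebraLift_ι _ _ _, subcoalgebraLift_ι _ _ _⟩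
    rw [fpCoalgebra_iff]
    exact ((Set.finite_range f.f).union (Set.finite_range f'.f)).to_subtype
  glue {E} h hh := by
    refine ⟨coalgebraHomMk h fun x => ?_, rfl⟩
    obtain ⟨C, hC, f, y, rfl⟩ := hL x
    obtain ⟨k, hk⟩ := hh ((fpCoalgebra_iff C).2 hC) f
    change f.f ≫ h = k.f at hk
    have := str_apply k y
    rw [← hk] at this
    refine this.trans ((map_apply_comp F f.f h _).trans ?_)
    exact congrArg (F.map h) (str_apply f y).symm

lemma IsRationalFixpoint.of_locallyFinite {R : Endofunctor.Coalgebra F} (hR : LocallyFinite R)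
    (hu : ∀ {C : Endofunctor.Coalgebra F}, Finite C.V → ∃! _f : C ⟶ R, True) :
    IsRationalFixpoint F R :=
  hR.isCovered.exists_isColimit fun hC => hu ((fpCoalgebra_iff _).1 hC)

/-- The union of the images of the legs is a subcoalgebra through which the whole cocone factors, so
its inclusion is split by the induced map and it is everything. -/
lemma exists_mem_range_of_isColimit {R : Endofunctor.Coalgebra F}
    {s : (fpCoalgebra F).ι ⟶ (Functor.const (fpCoalgebra F).FullSubcategory).obj R}
    (hs : IsColimit (Cocone.mk R s)) (x : R.V) : ∃ C, x ∈ Set.range (s.app C).f := by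
  let I : Set R.V := {x | ∃ C, x ∈ Set.range (s.app C).f}
  have hI : IsClosedUnder R I := isClosedUnder_of_cover fun x ⟨C, hC⟩ =>
    ⟨C.obj, s.app C, hC, fun y hy => ⟨C, hy⟩⟩
  let t : Cocone (fpCoalgebra F).ι :=
    { pt := subcoalgebra R I hI
      ι :=
        { app := fun C => subcoalgebraLift hI (s.app C) (fun x => ⟨C, x, rfl⟩)
          naturality := fun C B g => by
            have := s.naturality g
            ext x
            exact Subtype.ext (hom_congr this x) } }
  have key : hs.desc t ≫ subcoalgebraι R I hI = 𝟙 R := by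
    refine hs.hom_ext fun C => ?_
    rw [hs.fac_assoc, Category.comp_id]
    rfl
  have hx : ((hs.desc t).f x).1 = x :=
    hom_congr key x
  obtain ⟨C, hC⟩ := ((hs.desc t).f x).2
  exact ⟨C, hx ▸ hC⟩

lemma IsRationalFixpoint.locallyFinite {R : Endofunctor.Coalgebra F}
    (hR : IsRationalFixpoint F R) : LocallyFinite R := by
  obtain ⟨s, ⟨hs⟩⟩ := hR
  intro x
  obtain ⟨C, hC⟩ := exists_mem_range_of_isColimit hs x
  exact ⟨C.obj, (fpCoalgebra_iff _).1 C.property, s.app C, hC⟩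

/-- Any `h : C ⟶ R` lands in a finite subcoalgebra `J`, a union of finitely many images of legs. The
leg at `J` is the inclusion, so naturality along the corestriction of `h` identifies `h` with the
leg at `C`. -/
lemma IsRationalFixpoint.existsUnique_hom_of_finite {R : Endofunctor.Coalgebra F}
    (hR : IsRationalFixpoint F R) {C : Endofunctor.Coalgebra F} (hC : Finite C.V) :
    ∃! _f : C ⟶ R, True := by
  obtain ⟨s, ⟨hs⟩⟩ := hR
  refine ⟨s.app ⟨C, (fpCoalgebra_iff C).2 hC⟩, trivial, fun h _ => ?_⟩
  choose B hB using exists_mem_range_of_isColimit hs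
  let I : Set R.V := ⋃ y : C.V, Set.range (s.app (B (h.f y))).f
  have hI : IsClosedUnder R I := isClosedUnder_of_cover fun x hx => by
    obtain ⟨y, hy⟩ := Set.mem_iUnion.1 hx
    exact ⟨_, s.app (B (h.f y)), hy, fun z hz => Set.mem_iUnion.2 ⟨y, hz⟩⟩
  have hfin : Finite (subcoalgebra R I hI).V := by
    have : I.Finite := Set.finite_iUnion fun y => by
      have : Finite ((fpCoalgebra F).ι.obj (B (h.f y))).V :=
        (fpCoalgebra_iff _).1 (B (h.f y)).property
      exact Set.finite_range _
    exact this.to_subtype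
  let J : (fpCoalgebra F).FullSubcategory := ⟨subcoalgebra R I hI, (fpCoalgebra_iff _).2 hfin⟩
  -- Each point of `J` lies in the image of some leg, which factors as `e` through `J`; naturality
  -- along `e` computes the leg at `J` there.
  have hJ : s.app J = subcoalgebraι R I hI := by
    ext ⟨x, hx⟩
    obtain ⟨y, z, hz⟩ := Set.mem_iUnion.1 hx
    let e : B (h.f y) ⟶ J := ObjectProperty.homMk (subcoalgebraLift hI (s.app (B (h.f y)))
      (fun x => Set.mem_iUnion.2 ⟨y, x, rfl⟩))
    have h1 := hom_congr (s.naturality e) z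
    have h2 : e.hom.f z = ⟨x, hx⟩ := Subtype.ext hz
    change (s.app J).f (e.hom.f z) = (s.app (B (h.f y))).f z at h1
    rw [h2, hz] at h1
    exact h1
  let k : (⟨C, (fpCoalgebra_iff C).2 hC⟩ : (fpCoalgebra F).FullSubcategory) ⟶ J :=
    ObjectProperty.homMk (subcoalgebraLift hI h (fun y => Set.mem_iUnion.2 ⟨y, hB _⟩))
  have h1 := s.naturality k
  rw [hJ] at h1
  exact h1

end Coalgebra

/-! ### Existence of the rational fixpoint in sets -/

section Existence

variable {F : Type u ⥤ Type u}

/-- An equivalence relation is a congruence if the structure map descends to the quotient. -/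
def IsCongruence (S : Endofunctor.Coalgebra F) (E : Setoid S.V) : Prop :=
  ∀ x y, E x y → F.map (↾(Quotient.mk E)) (S.str x) = F.map (↾(Quotient.mk E)) (S.str y)

/-- The quotient of a coalgebra by a congruence. -/
def quotientCoalgebra (S : Endofunctor.Coalgebra F) (E : Setoid S.V) (hE : IsCongruence S E) :
    Endofunctor.Coalgebra F where
  V := Quotient E
  str := ↾(Quotient.lift (fun x => F.map (↾(Quotient.mk E)) (S.str x)) hE)

/-- The projection to the quotient by a congruence. -/
def quotientHom (S : Endofunctor.Coalgebra F) (E : Setoid S.V) (hE : IsCongruence S E) :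
    S ⟶ quotientCoalgebra S E hE :=
  coalgebraHomMk (↾(Quotient.mk E)) (fun _ => rfl)

lemma eq_of_le {S : Endofunctor.Coalgebra F} {E E' : Setoid S.V} (h : E ≤ E') {z z' : F.obj S.V}
    (hz : F.map (↾(Quotient.mk E)) z = F.map (↾(Quotient.mk E)) z') :
    F.map (↾(Quotient.mk E')) z = F.map (↾(Quotient.mk E')) z' := by
  have e : (↾(Quotient.mk E') : S.V ⟶ Quotient E') =
      (↾(Quotient.mk E) : S.V ⟶ Quotient E) ≫
        ↾(Quotient.lift (Quotient.mk E') (fun _ _ hxy => Quotient.sound (h hxy))) := rfl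
  rw [e, map_apply_comp, map_apply_comp, hz]

lemma isCongruence_eqvGen {S : Endofunctor.Coalgebra F} (r : S.V → S.V → Prop)
    (h : ∀ x y, r x y → F.map (↾(Quotient.mk (Relation.EqvGen.setoid r))) (S.str x) =
      F.map (↾(Quotient.mk (Relation.EqvGen.setoid r))) (S.str y)) :
    IsCongruence S (Relation.EqvGen.setoid r) := by
  intro x y hxy
  induction hxy with
  | rel x y hxy => exact h x y hxy
  | refl x => rfl
  | symm x y _ ih => exact ih.symm
  | trans x y z _ _ ih ih' => exact ih.trans ih'

/-- The largest congruence, generated by all congruences. -/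
def maxCongruence (S : Endofunctor.Coalgebra F) : Setoid S.V :=
  Relation.EqvGen.setoid (fun x y => ∃ E : Setoid S.V, IsCongruence S E ∧ E x y)

lemma le_maxCongruence {S : Endofunctor.Coalgebra F} {E : Setoid S.V} (hE : IsCongruence S E) :
    E ≤ maxCongruence S :=
  fun x y hxy => Relation.EqvGen.rel x y ⟨E, hE, hxy⟩

lemma isCongruence_max (S : Endofunctor.Coalgebra F) : IsCongruence S (maxCongruence S) :=
  isCongruence_eqvGen _ fun x y ⟨_, hE, hxy⟩ => eq_of_le (le_maxCongruence hE) (hE x y hxy)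

/-- The quotient by the largest congruence. -/
abbrev maxQuotient (S : Endofunctor.Coalgebra F) : Endofunctor.Coalgebra F :=
  quotientCoalgebra S (maxCongruence S) (isCongruence_max S)

/-- The pullback `K` of `E` along the projection is a congruence on `S`, hence lies below the
largest one. -/
lemma maxQuotient_congruence_trivial (S : Endofunctor.Coalgebra F)
    {E : Setoid (maxQuotient S).V} (hE : IsCongruence (maxQuotient S) E)
    {x y : (maxQuotient S).V} (hxy : E x y) : x = y := by
  induction x using Quotient.inductionOn with | h x
  induction y using Quotient.inductionOn with | h y
  let p : S.V → (maxQuotient S).V := Quotient.mk (maxCongruence S)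
  let K : Setoid S.V := E.comap p
  let j : Quotient E ⟶ Quotient K :=
    ↾(Quotient.lift (Quotient.lift (fun x => Quotient.mk K x) (fun a b hab =>
      Quotient.sound (show E (p a) (p b) from by rw [show p a = p b from Quotient.sound hab])))
      (by
        intro a b
        induction a using Quotient.inductionOn with | h a
        induction b using Quotient.inductionOn with | h b
        intro hab
        exact Quotient.sound hab))
  have hK : IsCongruence S K := by
    intro a b hab
    have h := congrArg (F.map j) (hE _ _ hab)
    have e : (↾(Quotient.mk K) : S.V ⟶ Quotient K) =
      (↾p : S.V ⟶ (maxQuotient S).V) ≫ (↾(Quotient.mk E)) ≫ j := rfl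
    rw [e, map_apply_comp, map_apply_comp, map_apply_comp, map_apply_comp]
    exact h
  exact Quotient.sound (le_maxCongruence hK hxy)

/-- Identifying `f a` with `g a` for all `a` generates a congruence, and congruences on this
quotient are trivial. -/
lemma hom_maxQuotient_eq {S A : Endofunctor.Coalgebra F} (f g : A ⟶ maxQuotient S) : f = g := by
  let r : (maxQuotient S).V → (maxQuotient S).V → Prop := fun x y => ∃ a, x = f.f a ∧ y = g.f a
  have hr : IsCongruence (maxQuotient S) (Relation.EqvGen.setoid r) := by
    refine isCongruence_eqvGen _ ?_
    rintro _ _ ⟨a, rfl, rfl⟩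
    rw [str_apply, str_apply, ← map_apply_comp, ← map_apply_comp]
    have e : f.f ≫ (↾(Quotient.mk (Relation.EqvGen.setoid r))) =
        g.f ≫ ↾(Quotient.mk (Relation.EqvGen.setoid r)) := by
      ext b
      exact Quotient.sound (Relation.EqvGen.rel _ _ ⟨b, rfl, rfl⟩)
    exact congrArg (fun k => F.map k (A.str a)) e
  ext a
  exact maxQuotient_congruence_trivial S hr (Relation.EqvGen.rel _ _ ⟨a, rfl, rfl⟩)

/-- The coproduct of all coalgebras carried by a standard finite set. -/
def finiteSum (F : Type u ⥤ Type u) : Endofunctor.Coalgebra F where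
  V := Σ p : (Σ n : ℕ, (ULift.{u} (Fin n) → F.obj (ULift.{u} (Fin n)))), ULift.{u} (Fin p.1)
  str := ↾(fun x => F.map (↾(fun j => Sigma.mk x.1 j)) (x.1.2 x.2))

lemma finiteSum_locallyFinite (F : Type u ⥤ Type u) : LocallyFinite (finiteSum F) := by
  rintro ⟨p, i⟩
  let C : Endofunctor.Coalgebra F := ⟨ULift.{u} (Fin p.1), ↾p.2⟩
  let f : C.V ⟶ (finiteSum F).V :=
    ↾(fun j : ULift.{u} (Fin p.1) => Sigma.mk p j)
  exact ⟨C, inferInstanceAs (Finite (ULift.{u} (Fin p.1))), coalgebraHomMk f (fun _ => rfl),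
    i, rfl⟩

lemma nonempty_hom_finiteSum (C : Endofunctor.Coalgebra F) (hC : Finite C.V) :
    Nonempty (C ⟶ finiteSum F) := by
  obtain ⟨n, ⟨e⟩⟩ := Finite.exists_equiv_fin C.V
  let e' : C.V ≃ ULift.{u} (Fin n) := e.trans Equiv.ulift.symm
  let p : Σ n : ℕ, (ULift.{u} (Fin n) → F.obj (ULift.{u} (Fin n))) :=
    ⟨n, fun i => F.map (↾e') (C.str (e'.symm i))⟩
  refine ⟨coalgebraHomMk (↾(fun x => ⟨p, e' x⟩)) (fun x => ?_)⟩
  have h : (↾(fun x => ⟨p, e' x⟩) : C.V ⟶ (finiteSum F).V) =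
    (↾e' : C.V ⟶ ULift.{u} (Fin n)) ≫ ↾(fun j => ⟨p, j⟩) := rfl
  rw [h, map_apply_comp]
  change F.map _ (F.map (↾e') (C.str (e'.symm (e' x)))) = _
  rw [e'.symm_apply_apply]
  rfl

lemma exists_isRationalFixpoint (F : Type u ⥤ Type u) [F.PreservesMonomorphisms] :
    ∃ R : Endofunctor.Coalgebra F, IsRationalFixpoint F R := by
  let q := quotientHom (finiteSum F) _ (isCongruence_max _)
  refine ⟨maxQuotient (finiteSum F), IsRationalFixpoint.of_locallyFinite ?_ ?_⟩
  · intro x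
    induction x using Quotient.inductionOn with | h x
    obtain ⟨C, hC, f, y, rfl⟩ := finiteSum_locallyFinite F x
    exact ⟨C, hC, f ≫ q, y, rfl⟩
  · intro C hC
    obtain ⟨f⟩ := nonempty_hom_finiteSum C hC
    exact ⟨f ≫ q, trivial, fun g _ => hom_maxQuotient_eq _ _⟩

end Existence

/-! ### Distributive laws and locally finite coalgebras -/

section Action

variable {V : Type u}

instance finite_finPermOn (W : Set V) [Finite W] : Finite (FinPermOn W) := by
  have hmem : ∀ (π : FinPermOn W) (w : W), (π.1 : Equiv.Perm V) w ∈ W := by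
    intro π w
    by_contra h
    -- If `π w` were outside `W` it would be fixed by `π`, and injectivity would give `π w = w`.
    have h1 := π.2 _ h
    exact h (by rw [(π.1 : Equiv.Perm V).injective h1]; exact w.2)
  refine Finite.of_injective (fun π => fun w : W => (⟨(π.1 : Equiv.Perm V) w, hmem π w⟩ : W)) ?_
  intro π σ h
  ext v
  by_cases hv : v ∈ W
  · exact congrArg Subtype.val (congrFun h ⟨v, hv⟩)
  · rw [π.2 v hv, σ.2 v hv]

lemma mem_finPermOn_support (π : FinPerm V) :
    π ∈ FinPermOn {v | (π : Equiv.Perm V) v ≠ v} :=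
  fun _ hv => not_not.1 hv

lemma exists_finite_finPermOn (T : Set (FinPerm V)) (hT : T.Finite) :
    ∃ W : Set V, W.Finite ∧ ∀ π ∈ T, π ∈ FinPermOn W := by
  refine ⟨⋃ π ∈ T, {v | (π : Equiv.Perm V) v ≠ v}, hT.biUnion (fun π _ => π.2), ?_⟩
  intro π hπ v hv
  by_contra h
  exact hv (Set.mem_biUnion hπ h)

variable {F : Type u ⥤ Type u} {lam : PermLaw V F}

lemma PermLaw.Localizable.exists_restriction (hloc : lam.Localizable) (W : Set V) (X : Type u) :
    ∃ l : FinPermOn W → F.obj X → F.obj (FinPermOn W × X), ∀ (π : FinPermOn W) (z : F.obj X),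
      lam.app X ((π : FinPerm V), z) =
        F.map (↾(fun p : FinPermOn W × X => ((p.1 : FinPerm V), p.2))) (l π z) := by
  obtain ⟨lW, h⟩ := hloc W
  exact ⟨fun π z => lW.app X (π, z), fun π z =>
    ConcreteCategory.congr_hom (h X) ((π, z) : FinPermOn W × F.obj X)⟩

variable (lam)

/-- The functoriality of `prodCoalgebra`. -/
def prodMap {A B : Endofunctor.Coalgebra F} (f : A ⟶ B) :
    lam.prodCoalgebra A ⟶ lam.prodCoalgebra B :=
  coalgebraHomMk (↾(fun p : FinPerm V × A.V => (p.1, f.f p.2))) fun p => by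
    change lam.app B.V (p.1, B.str (f.f p.2)) = F.map _ (lam.app A.V (p.1, A.str p.2))
    rw [str_apply, PermLaw.app_natural]
    rfl

/-- The unit of the monad, as a homomorphism. -/
def unitHom (A : Endofunctor.Coalgebra F) : A ⟶ lam.prodCoalgebra A :=
  coalgebraHomMk (↾(fun x : A.V => ((1 : FinPerm V), x))) fun x => lam.app_one A.V (A.str x)

/-- The multiplication of the monad, as a homomorphism. -/
def multHom (A : Endofunctor.Coalgebra F) :
    lam.prodCoalgebra (lam.prodCoalgebra A) ⟶ lam.prodCoalgebra A :=
  coalgebraHomMk (↾(fun p : FinPerm V × (FinPerm V × A.V) => (p.1 * p.2.1, p.2.2))) fun p =>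
    lam.app_mul A.V p.1 p.2.1 (A.str p.2.2)

variable {lam}

/-- The law for a finite `W` containing the names moved by `π` makes `FinPermOn W × C` a finite
coalgebra mapping onto the required point. -/
lemma LocallyFinite.prodCoalgebra (hloc : lam.Localizable) {L : Endofunctor.Coalgebra F}
    (hL : LocallyFinite L) : LocallyFinite (lam.prodCoalgebra L) := by
  rintro ⟨π, x⟩
  obtain ⟨C, hC, f, y, rfl⟩ := hL x
  obtain ⟨W, hW, hπ⟩ := exists_finite_finPermOn {π} (Set.finite_singleton π)
  have := hW.to_subtype
  obtain ⟨l, hl⟩ := hloc.exists_restriction W C.V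
  let B : Endofunctor.Coalgebra F := ⟨FinPermOn W × C.V, ↾(fun p => l p.1 (C.str p.2))⟩
  let i : B.V ⟶ (lam.prodCoalgebra C).V :=
    ↾(fun p : FinPermOn W × C.V => ((p.1 : FinPerm V), p.2))
  refine ⟨B, inferInstanceAs (Finite (FinPermOn W × C.V)),
    coalgebraHomMk i (fun p => hl p.1 (C.str p.2)) ≫ prodMap lam f, ⟨(⟨π, hπ π rfl⟩, y), rfl⟩⟩

/-! ### Coalgebras for the lifting -/

variable (lam) in
/-- The coalgebra in sets underlying a coalgebra for the lifting. -/
def underlying (hnom : lam.NomRestricting) :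
    Endofunctor.Coalgebra (lam.nomLift hnom) ⥤ Endofunctor.Coalgebra F where
  obj C := ⟨C.V.obj.V, C.str.hom.hom⟩
  map f := ⟨f.f.hom.hom, congrArg (fun g => g.hom.hom) f.h⟩

/-- The action on a coalgebra for the lifting is a homomorphism. -/
def actHom {hnom : lam.NomRestricting} (C : Endofunctor.Coalgebra (lam.nomLift hnom)) :
    lam.prodCoalgebra ((underlying lam hnom).obj C) ⟶ (underlying lam hnom).obj C :=
  coalgebraHomMk (actMap C.V.obj) fun p =>
    ConcreteCategory.congr_hom (C.str.hom.comm p.1) p.2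

/-- A set with an action of the finite permutations is finitely generated if it is the union of
the orbits of finitely many elements. -/
def IsFinitelyGenerated (X : PermSet V) : Prop :=
  ∃ S : Set X.V, S.Finite ∧ ∀ x, ∃ (π : FinPerm V), ∃ s ∈ S, X.ρ π s = x

lemma PermSet.mul_apply (X : PermSet V) (π σ : FinPerm V) (x : X.V) :
    X.ρ (π * σ) x = X.ρ π (X.ρ σ x) := by
  rw [map_mul]
  rfl

lemma PermSet.one_apply (X : PermSet V) (x : X.V) : X.ρ 1 x = x := by
  rw [map_one]
  rfl

/-- The structure of the finitely many generators involves only finitely many permutations, since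
`F` is finitary. All of them live in `FinPermOn W` for some finite `W`, and the restricted law
extends the structure from `S` to the finite set `FinPermOn W × S`. -/
lemma IsFinitelyGenerated.locallyFinite [PreservesFilteredColimits F] (hloc : lam.Localizable)
    {hnom : lam.NomRestricting}
    {C : Endofunctor.Coalgebra (lam.nomLift hnom)} (hC : IsFinitelyGenerated C.V.obj) :
    LocallyFinite ((underlying lam hnom).obj C) := by
  obtain ⟨S, hS, hgen⟩ := hC
  intro x₀
  obtain ⟨π₀, s₀, hs₀, h₀⟩ := hgen x₀
  let X : PermSet V := C.V.obj
  let c : X.V ⟶ F.obj X.V := C.str.hom.hom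
  let gen : (FinPerm V × S : Type u) ⟶ X.V := ↾(fun p => X.ρ p.1 p.2.1)
  -- lift the structure of the generators along the surjection `FinPerm V × S → C`
  have hlift : ∀ s : S, ∃ z : F.obj (FinPerm V × S), F.map gen z = c s.1 := by
    choose π s hs h using hgen
    let sec : X.V ⟶ (FinPerm V × S : Type u) := ↾(fun x => (π x, ⟨s x, hs x⟩))
    have hsec : sec ≫ gen = 𝟙 X.V := by
      ext x
      exact h x
    intro t
    refine ⟨F.map sec (c t.1), ?_⟩
    rw [← map_apply_comp, hsec, F.map_id]
    rfl
  choose z hz using hlift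
  choose T hT hzT using fun s => exists_finite_mem_range_map F (z s)
  have := hS.to_subtype
  -- Including `π₀` ensures that `x₀` itself is in the image.
  obtain ⟨W, hW, hWT⟩ := exists_finite_finPermOn
    (insert π₀ (⋃ s, Prod.fst '' T s)) ((Set.finite_iUnion fun s => (hT s).image _).insert _)
  have := hW.to_subtype
  let i : (FinPermOn W × S : Type u) ⟶ (FinPerm V × S : Type u) :=
    ↾(fun p => ((p.1 : FinPerm V), p.2))
  have hd : ∀ s : S, ∃ d : F.obj (FinPermOn W × S), F.map i d = z s := by
    intro s
    obtain ⟨t, ht⟩ := hzT s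
    let j : (T s : Type u) ⟶ (FinPermOn W × S : Type u) :=
      ↾(fun p => (⟨p.1.1, hWT _ (Or.inr (Set.mem_iUnion.2 ⟨s, ⟨p.1, p.2, rfl⟩⟩))⟩, p.1.2))
    refine ⟨F.map j t, ?_⟩
    rw [← map_apply_comp, ← ht]
    rfl
  choose d hd using hd
  obtain ⟨l, hl⟩ := hloc.exists_restriction W (FinPermOn W × S)
  let m : (FinPermOn W × (FinPermOn W × S) : Type u) ⟶ (FinPermOn W × S : Type u) :=
    ↾(fun p => (p.1 * p.2.1, p.2.2))
  let B : Endofunctor.Coalgebra F := ⟨FinPermOn W × S, ↾(fun p => F.map m (l p.1 (d p.2)))⟩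
  let f : B ⟶ (underlying lam hnom).obj C := coalgebraHomMk (i ≫ gen) fun p => by
    have e1 : c (X.ρ p.1.1 p.2.1) =
        F.map (actMap X) (lam.app X.V (p.1.1, c p.2.1)) :=
      ConcreteCategory.congr_hom (C.str.hom.comm p.1.1) p.2.1
    refine e1.trans ?_
    have e2 : m ≫ i ≫ gen = (↾(fun p : FinPermOn W × (FinPermOn W × S) =>
        ((p.1 : FinPerm V), p.2)) : _ ⟶ (FinPerm V × (FinPermOn W × S) : Type u)) ≫
        (↾(fun p : FinPerm V × (FinPermOn W × S) => (p.1, (i ≫ gen) p.2))) ≫ actMap X := by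
      ext p
      exact PermSet.mul_apply X _ _ _
    change _ = F.map (i ≫ gen) (F.map m (l p.1 (d p.2)))
    rw [← hz, ← hd, ← map_apply_comp, PermLaw.app_natural, hl, ← map_apply_comp, ← map_apply_comp,
      ← map_apply_comp, e2]
  exact ⟨B, inferInstanceAs (Finite (FinPermOn W × S)), f,
    (⟨π₀, hWT _ (Or.inl rfl)⟩, ⟨s₀, hs₀⟩), h₀⟩

/-! ### Properties of the action on the rational fixpoint -/

variable [F.PreservesMonomorphisms]

lemma IsRationalFixpoint.existsUnique_hom {R : Endofunctor.Coalgebra F}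
    (hR : IsRationalFixpoint F R) {L : Endofunctor.Coalgebra F} (hL : LocallyFinite L) :
    ∃! _f : L ⟶ R, True :=
  hL.isCovered.existsUnique_hom fun hC => hR.existsUnique_hom_of_finite ((fpCoalgebra_iff _).1 hC)

section Laws

variable {R : Endofunctor.Coalgebra F} (hR : IsRationalFixpoint F R)
  (a : lam.prodCoalgebra R ⟶ R)
include hR

/-- Both action laws are equalities of homomorphisms into `R` with locally finite domain, hence hold
by uniqueness. -/
lemma action_one (x : R.V) : a.f (1, x) = x :=
  hom_congr ((hR.existsUnique_hom hR.locallyFinite).unique trivial trivial :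
    unitHom lam R ≫ a = 𝟙 R) x

lemma action_mul (hloc : lam.Localizable) (π σ : FinPerm V) (x : R.V) :
    a.f (π * σ, x) = a.f (π, a.f (σ, x)) :=
  hom_congr ((hR.existsUnique_hom
      ((hR.locallyFinite.prodCoalgebra hloc).prodCoalgebra hloc)).unique trivial trivial :
    multHom lam R ≫ a = prodMap lam a ≫ a) (π, (σ, x))

lemma action_finitely_supported (hloc : lam.Localizable) (hnom : lam.NomRestricting) (x : R.V) :
    ∃ A : Set V, A.Finite ∧
      ∀ π : FinPerm V, (∀ v ∈ A, (π : Equiv.Perm V) v = v) → a.f (π, x) = x := by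
  obtain ⟨C, hC, f, y, rfl⟩ := hR.locallyFinite x
  let T : PermSet V := ⟨C.V, 1⟩
  have hT : isNominal V T := fun x => ⟨∅, Set.finite_empty, fun _ _ => rfl⟩
  choose A hA hsupp using fun y : C.V => hnom T hT (C.str y)
  refine ⟨⋃ y, A y, Set.finite_iUnion hA, fun π hπ => ?_⟩
  let W : Set V := {v | (π : Equiv.Perm V) v ≠ v}
  have : Finite W := π.2
  -- An element of `FinPermOn W` moves only names moved by `π`, none of which lies in the chosen
  -- supports.
  have hfix : ∀ (σ : FinPermOn W) (y : C.V), lam.liftAct T σ (C.str y) = C.str y := by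
    intro σ y
    refine hsupp y σ fun v hv => σ.2 v ?_
    exact not_not.2 (hπ v (Set.mem_iUnion.2 ⟨y, hv⟩))
  obtain ⟨l, hl⟩ := hloc.exists_restriction W C.V
  let B : Endofunctor.Coalgebra F := ⟨FinPermOn W × C.V, ↾(fun p => l p.1 (C.str p.2))⟩
  let i : B.V ⟶ (lam.prodCoalgebra C).V :=
    ↾(fun p : FinPermOn W × C.V => ((p.1 : FinPerm V), p.2))
  -- As the action on `T` is trivial, `actMap T` is the projection, so `hfix` says precisely that
  -- projecting is a homomorphism.
  let q : B ⟶ C := coalgebraHomMk (↾(fun p : FinPermOn W × C.V => p.2)) fun p => by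
    refine (hfix p.1 p.2).symm.trans ?_
    rw [PermLaw.liftAct, hl, ← map_apply_comp]
    rfl
  have e : (coalgebraHomMk i (fun p => hl p.1 (C.str p.2)) : B ⟶ lam.prodCoalgebra C) ≫
      prodMap lam f ≫ a = q ≫ f :=
    (hR.existsUnique_hom_of_finite
      (inferInstanceAs (Finite (FinPermOn W × C.V)))).unique trivial trivial
  exact hom_congr e (⟨π, mem_finPermOn_support π⟩, y)

end Laws

end Action

/-! ### Double cosets of finite permutations -/

section DoubleCosets

variable {V : Type u}

/-- An injection of a finite set into a larger finite set extends to a finite permutation. -/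
lemma exists_finPermOn_extending (Z : Finset V) {S : Set V} {f : V → V} (hSZ : S ⊆ Z)
    (hf : Set.MapsTo f S Z) (hinj : Set.InjOn f S) :
    ∃ π : FinPerm V, π ∈ FinPermOn (Z : Set V) ∧ ∀ v ∈ S, (π : Equiv.Perm V) v = f v := by
  classical
  obtain ⟨g, hg⟩ := Set.MapsTo.exists_equiv_extend_of_card_eq (α := Z) (t := Z)
    (Fintype.card_coe Z) (s := {z : Z | z.1 ∈ S}) (f := fun z => f z.1)
    (fun z hz => hf hz) (fun z hz z' hz' h => Subtype.ext (hinj hz hz' h))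
  let p : Equiv.Perm V := Equiv.Perm.ofSubtype (p := fun v => v ∈ Z) g
  have hp : ∀ v, v ∉ Z → p v = v := fun v hv => Equiv.Perm.ofSubtype_apply_of_not_mem g hv
  refine ⟨⟨p, Z.finite_toSet.subset fun v hv => ?_⟩, fun v hv => hp v hv, fun v hv => ?_⟩
  · by_contra h
    exact hv (hp v h)
  · exact (Equiv.Perm.ofSubtype_apply_of_mem g (hSZ hv)).trans (hg ⟨v, hSZ hv⟩ hv)

/-- The pointwise stabilizer of a finite set of names has finitely many double cosets. -/
lemma exists_finite_doubleCosets (C : Finset V) :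
    ∃ T : Set (FinPerm V), T.Finite ∧ ∀ g : FinPerm V, ∃ t ∈ T, ∃ h k : FinPerm V,
      (∀ v ∈ C, (h : Equiv.Perm V) v = v) ∧ (∀ v ∈ C, (k : Equiv.Perm V) v = v) ∧
        g = h * t * k := by
  classical
  rcases finite_or_infinite V with hV | hV
  · exact ⟨Set.univ, Set.toFinite _, fun g => ⟨g, trivial, 1, 1, fun _ _ => rfl, fun _ _ => rfl,
      by simp⟩⟩
  -- Twice the size of `C` leaves room in `W` outside `C` for the part of `g(C)` not in `C`. The
  -- permutation `h` moves that part into `W` while fixing `C`, so `h * g` agrees on `C` with some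
  -- `t` supported in `W`.
  obtain ⟨W, hCW, hW⟩ := Infinite.exists_superset_card_eq C (C.card + C.card) (by omega)
  have : Finite (W : Set V) := W.finite_toSet
  refine ⟨(FinPermOn (W : Set V) : Set (FinPerm V)),
    Set.finite_coe_iff.1 (finite_finPermOn (W : Set V)), fun g => ?_⟩
  let B : Finset V := C.image (g : Equiv.Perm V)
  have hcard : Fintype.card ↥(B \ C) ≤ Fintype.card ↥(W \ C) := by
    rw [Fintype.card_coe, Fintype.card_coe, Finset.card_sdiff_of_subset hCW, hW,
      Nat.add_sub_cancel]
    exact (Finset.card_le_card Finset.sdiff_subset).trans Finset.card_image_le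
  obtain ⟨j⟩ := Function.Embedding.nonempty_of_card_le hcard
  let f : V → V := fun v => if hv : v ∈ B \ C then (j ⟨v, hv⟩ : V) else v
  have hf1 : ∀ v (hv : v ∈ B \ C), f v = j ⟨v, hv⟩ := fun v hv => dif_pos hv
  have hf2 : ∀ v ∈ C, f v = v := fun v hv =>
    dif_neg fun h => (Finset.mem_sdiff.1 h).2 hv
  have hj : ∀ x, (j x : V) ∈ W ∧ (j x : V) ∉ C := fun x => Finset.mem_sdiff.1 (j x).2
  have hmem : ∀ v, v ∈ B ∪ C → v ∈ C ∨ v ∈ B \ C := fun v hv => by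
    rcases Finset.mem_union.1 hv with h | h
    · by_cases hC : v ∈ C
      · exact Or.inl hC
      · exact Or.inr (Finset.mem_sdiff.2 ⟨h, hC⟩)
    · exact Or.inl h
  have hfW : ∀ v ∈ B ∪ C, f v ∈ W := fun v hv => by
    rcases hmem v hv with h | h
    · rw [hf2 v h]
      exact hCW h
    · rw [hf1 v h]
      exact (hj _).1
  obtain ⟨h, -, hh⟩ := exists_finPermOn_extending (B ∪ C ∪ W) (S := ((B ∪ C : Finset V) : Set V))
    (f := f) (fun v hv => Finset.mem_coe.2 (Finset.mem_union_left _ hv))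
    (fun v hv => Finset.mem_coe.2 (Finset.mem_union_right _ (hfW v hv)))
    (by
      intro v hv w hw e
      rcases hmem v hv with h1 | h1 <;> rcases hmem w hw with h2 | h2
      · rwa [hf2 v h1, hf2 w h2] at e
      · rw [hf2 v h1, hf1 w h2] at e
        exact absurd (e ▸ h1) (hj _).2
      · rw [hf1 v h1, hf2 w h2] at e
        exact absurd (e ▸ h2) (hj _).2
      · rw [hf1 v h1, hf1 w h2] at e
        exact congrArg Subtype.val (j.injective (Subtype.ext e)))
  have hhC : ∀ v ∈ C, (h : Equiv.Perm V) v = v := fun v hv => by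
    rw [hh v (Finset.mem_coe.2 (Finset.mem_union_right _ hv)), hf2 v hv]
  obtain ⟨t, ht, htv⟩ := exists_finPermOn_extending W (S := (C : Set V))
    (f := fun v => ((h * g : FinPerm V) : Equiv.Perm V) v) (fun v hv => hCW hv)
    (fun v hv => by
      have hgv : (g : Equiv.Perm V) v ∈ B ∪ C :=
        Finset.mem_union_left _ (Finset.mem_image_of_mem _ hv)
      change (h : Equiv.Perm V) ((g : Equiv.Perm V) v) ∈ (W : Set V)
      rw [hh _ (Finset.mem_coe.2 hgv)]
      exact hfW _ hgv)
    (fun v _ w _ e => Equiv.injective _ e)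
  refine ⟨t, ht, h⁻¹, t⁻¹ * (h * g), fun v hv => ?_, fun v hv => ?_, by group⟩
  · rw [Subgroup.coe_inv, Equiv.Perm.inv_eq_iff_eq, hhC v hv]
  · rw [Subgroup.coe_mul, Equiv.Perm.mul_apply, Subgroup.coe_inv, Equiv.Perm.inv_eq_iff_eq]
    exact (htv v hv).symm

end DoubleCosets

/-! ### Colimits of nominal sets -/

section NomColimits

variable {V : Type u}

lemma hom_ρ {X Y : PermSet V} (f : X ⟶ Y) (π : FinPerm V) (x : X.V) :
    f.hom (X.ρ π x) = Y.ρ π (f.hom x) :=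
  ConcreteCategory.congr_hom (f.comm π) x

lemma Supports.map {X Y : PermSet V} (f : X ⟶ Y) {A : Set V} {x : X.V} (h : Supports A x) :
    Supports A (f.hom x) := fun π hπ => by rw [← hom_ρ, h π hπ]

instance (J : Type u) [SmallCategory J] : (isNominal V).IsClosedUnderColimitsOfShape J where
  colimitsOfShape_le := by
    rintro X ⟨h⟩ x
    obtain ⟨j, y, rfl⟩ := Types.jointly_surjective_of_isColimit
      (isColimitOfPreserves (Action.forget (Type u) (FinPerm V)) h.isColimit) x
    obtain ⟨A, hA, hs⟩ := h.prop_diag_obj j y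
    exact ⟨A, hA, hs.map (h.ι.app j)⟩

variable (V) in
/-- The underlying set of a nominal set. -/
abbrev nomForget : Nom V ⥤ Type u := (isNominal V).ι ⋙ Action.forget (Type u) (FinPerm V)

instance : (nomForget V).ReflectsIsomorphisms where
  reflects f hf := by
    have : IsIso f.hom.hom := hf
    have : IsIso ((isNominal V).ι.map f) := Action.isIso_of_hom_isIso f.hom
    exact isIso_of_reflects_iso f (isNominal V).ι

instance (J : Type u) [SmallCategory J] : ReflectsColimitsOfShape J (nomForget V) :=
  reflectsColimitsOfShape_of_reflectsIsomorphisms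

/-- The forgetful functor to sets preserves and reflects these colimits, and carries the lifting to
`F`. -/
lemma preservesFilteredColimits_nomLift {F : Type u ⥤ Type u} [PreservesFilteredColimits F]
    {lam : PermLaw V F} (hnom : lam.NomRestricting) :
    PreservesFilteredColimits (lam.nomLift hnom) where
  preserves_filtered_colimits J _ _ := by
    have : PreservesColimitsOfShape J (lam.nomLift hnom ⋙ nomForget V) :=
      inferInstanceAs (PreservesColimitsOfShape J (nomForget V ⋙ F))
    exact preservesColimitsOfShape_of_reflects_of_preserves _ (nomForget V)

end NomColimits

/-! ### Finitely generated nominal sets -/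

section FinitelyGenerated

variable {V : Type u}

lemma PermSet.ρ_inv_apply_eq {X : PermSet V} {π : FinPerm V} {x y : X.V} :
    X.ρ π⁻¹ x = y ↔ x = X.ρ π y := by
  constructor
  · rintro rfl
    rw [← PermSet.mul_apply, mul_inv_cancel, PermSet.one_apply]
  · rintro rfl
    rw [← PermSet.mul_apply, inv_mul_cancel, PermSet.one_apply]

/-- A set of generators of a set with an action. -/
def Generates {X : PermSet V} (S : Set X.V) : Prop :=
  ∀ x, ∃ (π : FinPerm V), ∃ s ∈ S, X.ρ π s = x

lemma Generates.hom_ext {X Y : PermSet V} {S : Set X.V} (hS : Generates S) {f g : X ⟶ Y}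
    (h : ∀ s ∈ S, f.hom s = g.hom s) : f = g := by
  ext x
  obtain ⟨π, s, hs, rfl⟩ := hS x
  change f.hom (X.ρ π s) = g.hom (X.ρ π s)
  rw [hom_ρ, hom_ρ, h s hs]

/-- A map on generators extends equivariantly once it respects the relations `π s = s'`. -/
lemma Generates.exists_hom {X Y : PermSet V} {S : Set X.V} (hS : Generates S) (y : S → Y.V)
    (hy : ∀ (π : FinPerm V) (s s' : S), X.ρ π s.1 = s'.1 → Y.ρ π (y s) = y s') :
    ∃ f : X ⟶ Y, ∀ s : S, f.hom s.1 = y s := by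
  choose π s hs e using hS
  let f : X.V ⟶ Y.V := ↾(fun x => Y.ρ (π x) (y ⟨s x, hs x⟩))
  have key : ∀ (σ : FinPerm V) (t : S), f (X.ρ σ t.1) = Y.ρ σ (y t) := by
    intro σ t
    have h1 : X.ρ (σ⁻¹ * π (X.ρ σ t.1)) (s (X.ρ σ t.1)) = t.1 := by
      rw [PermSet.mul_apply, PermSet.ρ_inv_apply_eq, e]
    have h2 := hy _ ⟨_, hs _⟩ t h1
    rw [PermSet.mul_apply, PermSet.ρ_inv_apply_eq] at h2
    exact h2
  refine ⟨{ hom := f, comm := fun σ => ?_ }, fun t => ?_⟩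
  · ext x
    have h1 := key (σ * π x) ⟨s x, hs x⟩
    rw [PermSet.mul_apply, PermSet.mul_apply, e x] at h1
    exact h1
  · have := key 1 t
    rwa [PermSet.one_apply, PermSet.one_apply] at this

/-- Finitely many conditions that hold eventually in a filtered category hold simultaneously. -/
lemma exists_hom_forall_of_finite {J : Type u} [SmallCategory J] [IsFiltered J] {ι : Type*}
    [Finite ι] (j : J) (Q : ι → ∀ k, (j ⟶ k) → Prop)
    (hQ : ∀ i k l (f : j ⟶ k) (g : k ⟶ l), Q i k f → Q i l (f ≫ g))
    (hex : ∀ i, ∃ k f, Q i k f) : ∃ k f, ∀ i, Q i k f := by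
  have : ∀ s : Set ι, s.Finite → ∃ k f, ∀ i ∈ s, Q i k f := by
    intro s hs
    induction s, hs using Set.Finite.induction_on with
    | empty => exact ⟨j, 𝟙 j, fun i hi => hi.elim⟩
    | @insert i s _ _ ih =>
      obtain ⟨k, f, hf⟩ := ih
      obtain ⟨k', f', hf'⟩ := hex i
      obtain ⟨l, g, g', e⟩ := IsFiltered.span f f'
      refine ⟨l, f ≫ g, ?_⟩
      rintro i' (rfl | hi')
      · rw [e]
        exact hQ _ _ _ _ _ hf'
      · exact hQ _ _ _ _ _ (hf i' hi')
  obtain ⟨k, f, h⟩ := this Set.univ Set.finite_univ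
  exact ⟨k, f, fun i => h i trivial⟩

/-- The images of the generators lift to one stage of the colimit, but infinitely many relations `π
s = s'` must hold there. Modulo the pointwise stabilizer of a common support of the generators and
their lifts, only finitely many double cosets of `π` matter, so a single later stage suffices. -/
lemma isFinitelyPresentable_of_isFinitelyGenerated (X : Nom V) (hX : IsFinitelyGenerated X.obj) :
    IsFinitelyPresentable.{u} X := by
  obtain ⟨S, hSfin, hS⟩ := hX
  classical
  have := hSfin.to_subtype
  rw [isFinitelyPresentable_iff_preservesFilteredColimits]
  refine ⟨fun J _ _ => ⟨fun {K} => ⟨fun {c} hc => ⟨?_⟩⟩⟩⟩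
  have hc' := isColimitOfPreserves (nomForget V) hc
  refine Types.FilteredColimit.isColimitOf' _ _ (fun f => ?_) (fun j f g h => ?_)
  · change X ⟶ c.pt at f
    choose j y hy using fun s : S => Types.jointly_surjective_of_isColimit hc' (f.hom.hom s.1)
    obtain ⟨j₀, hj₀⟩ := IsFiltered.sup_objs_exists (Set.finite_range j).toFinset
    have e : ∀ s, Nonempty (j s ⟶ j₀) := fun s =>
      hj₀ ((Set.finite_range j).mem_toFinset.2 ⟨s, rfl⟩)
    let z : S → (K.obj j₀).obj.V := fun s => (K.map (e s).some).hom.hom (y s)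
    have hz : ∀ s, (c.ι.app j₀).hom.hom (z s) = f.hom.hom s.1 := fun s =>
      (ConcreteCategory.congr_hom
        (congrArg (fun k : K.obj (j s) ⟶ c.pt => k.hom.hom) (c.w (e s).some)) (y s)).trans (hy s)
    choose A hA hAs using fun s : S => X.property s.1
    choose B hB hBz using fun s : S => (K.obj j₀).property (z s)
    have hfin : (⋃ s, (A s ∪ B s)).Finite := Set.finite_iUnion fun s => (hA s).union (hB s)
    obtain ⟨T, hT, hdc⟩ := exists_finite_doubleCosets hfin.toFinset
    have := hT.to_subtype
    have hfixX : ∀ (π : FinPerm V), (∀ v ∈ hfin.toFinset, (π : Equiv.Perm V) v = v) →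
        ∀ s : S, X.obj.ρ π s.1 = s.1 := fun π hπ s => hAs s π fun v hv =>
      hπ v (hfin.mem_toFinset.2 (Set.mem_iUnion.2 ⟨s, Or.inl hv⟩))
    have hfixz : ∀ (π : FinPerm V), (∀ v ∈ hfin.toFinset, (π : Equiv.Perm V) v = v) →
        ∀ s : S, (K.obj j₀).obj.ρ π (z s) = z s := fun π hπ s => hBz s π fun v hv =>
      hπ v (hfin.mem_toFinset.2 (Set.mem_iUnion.2 ⟨s, Or.inr hv⟩))
    obtain ⟨k, u, hu⟩ := exists_hom_forall_of_finite (ι := T × S × S) j₀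
      (fun q k u => X.obj.ρ q.1.1 q.2.1.1 = q.2.2.1 →
        (K.map u).hom.hom ((K.obj j₀).obj.ρ q.1.1 (z q.2.1)) = (K.map u).hom.hom (z q.2.2))
      (fun q k l u v hq hX => by
        rw [K.map_comp]
        exact congrArg (K.map v).hom.hom (hq hX))
      (fun q => by
        by_cases hq : X.obj.ρ q.1.1 q.2.1.1 = q.2.2.1
        · have h1 : (c.ι.app j₀).hom.hom ((K.obj j₀).obj.ρ q.1.1 (z q.2.1)) =
              (c.ι.app j₀).hom.hom (z q.2.2) := by
            refine (hom_ρ (c.ι.app j₀).hom _ _).trans ?_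
            rw [hz, hz, ← hq, hom_ρ]
            rfl
          obtain ⟨k, u, hu⟩ := (Types.FilteredColimit.isColimit_eq_iff' hc' _ _).1 h1
          exact ⟨k, u, fun _ => hu⟩
        · exact ⟨j₀, 𝟙 j₀, fun h => (hq h).elim⟩)
    obtain ⟨g, hg⟩ := Generates.exists_hom hS (Y := (K.obj k).obj)
      (fun s => (K.map u).hom.hom (z s)) (fun π s s' hπ => by
        obtain ⟨t, ht, h, h', hh, hh', rfl⟩ := hdc π
        -- The factors `h` and `h'` fix all generators, so the relation for `π` reduces to that for
        -- the representative `t`.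
        have h1 : X.obj.ρ t s.1 = s'.1 := by
          rw [PermSet.mul_apply, PermSet.mul_apply, hfixX h' hh'] at hπ
          have h2 := hfixX h hh s'
          rw [← PermSet.ρ_inv_apply_eq.2 hπ.symm]
          exact (PermSet.ρ_inv_apply_eq.2 h2.symm)
        have h2 := hu (⟨t, ht⟩, s, s') h1
        rw [← hom_ρ, PermSet.mul_apply, PermSet.mul_apply, hfixz h' hh', hom_ρ, h2, ← hom_ρ,
          hfixz h hh])
    refine ⟨k, ObjectProperty.homMk g, ?_⟩
    apply (isNominal V).hom_ext
    refine Generates.hom_ext hS fun s hs => ?_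
    change f.hom.hom s = (c.ι.app k).hom.hom (g.hom s)
    rw [hg ⟨s, hs⟩, ← hz ⟨s, hs⟩]
    exact (ConcreteCategory.congr_hom
      (congrArg (fun k : K.obj j₀ ⟶ c.pt => k.hom.hom) (c.w u)) (z ⟨s, hs⟩)).symm
  · change X ⟶ K.obj j at f g
    change f ≫ c.ι.app j = g ≫ c.ι.app j at h
    obtain ⟨k, u, hu⟩ := exists_hom_forall_of_finite (ι := S) j
      (fun s k u => (K.map u).hom.hom (f.hom.hom s.1) = (K.map u).hom.hom (g.hom.hom s.1))
      (fun s k l u v hs => by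
        rw [K.map_comp]
        exact congrArg (K.map v).hom.hom hs)
      (fun s => (Types.FilteredColimit.isColimit_eq_iff' hc' _ _).1
        (ConcreteCategory.congr_hom (congrArg (fun k : X ⟶ c.pt => k.hom.hom) h) s.1))
    refine ⟨k, u, ?_⟩
    apply (isNominal V).hom_ext
    exact Generates.hom_ext hS fun s hs => hu ⟨s, hs⟩

/-- A subset stable under the action. -/
def IsStable {X : PermSet V} (I : Set X.V) : Prop :=
  ∀ (π : FinPerm V), ∀ x ∈ I, X.ρ π x ∈ I

/-- The action on a stable subset. -/
def subAction (X : PermSet V) (I : Set X.V) (hI : IsStable I) : PermSet V where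
  V := I
  ρ :=
    { toFun := fun π => ↾(fun x : I => (⟨X.ρ π x.1, hI π x.1 x.2⟩ : I))
      map_one' := ConcreteCategory.hom_ext _ _ fun x =>
        Subtype.ext (PermSet.one_apply X x.1)
      map_mul' := fun π σ => ConcreteCategory.hom_ext _ _ fun x =>
        Subtype.ext (PermSet.mul_apply X π σ x.1) }

/-- The inclusion of a stable subset. -/
def subActionι (X : PermSet V) (I : Set X.V) (hI : IsStable I) : subAction X I hI ⟶ X where
  hom := incl I
  comm _ := rfl

lemma isNominal_subAction {X : PermSet V} (hX : isNominal V X) (I : Set X.V) (hI : IsStable I) :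
    isNominal V (subAction X I hI) := fun x => by
  obtain ⟨A, hA, h⟩ := hX x.1
  exact ⟨A, hA, fun π hπ => Subtype.ext (h π hπ)⟩

/-- The union of the orbits of the elements of a set. -/
def orbits {X : PermSet V} (S : Set X.V) : Set X.V := {x | ∃ π : FinPerm V, ∃ s ∈ S, X.ρ π s = x}

lemma isStable_orbits {X : PermSet V} (S : Set X.V) : IsStable (orbits S) := by
  rintro σ _ ⟨π, s, hs, rfl⟩
  exact ⟨σ * π, s, hs, PermSet.mul_apply X σ π s⟩

lemma subset_orbits {X : PermSet V} (S : Set X.V) : S ⊆ orbits S :=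
  fun s hs => ⟨1, s, hs, PermSet.one_apply X s⟩

lemma isFinitelyGenerated_orbits {X : PermSet V} {S : Set X.V} (hS : S.Finite) :
    IsFinitelyGenerated (subAction X (orbits S) (isStable_orbits S)) := by
  have := hS.to_subtype
  refine ⟨Set.range (fun s : S => (⟨s.1, subset_orbits S s.2⟩ : orbits S)), Set.finite_range _, ?_⟩
  rintro ⟨_, π, s, hs, rfl⟩
  exact ⟨π, _, ⟨⟨s, hs⟩, rfl⟩, rfl⟩

/-- The diagram of the nominal subsets generated by finitely many elements. -/
def finiteOrbits (X : Nom V) : Finset X.obj.V ⥤ Nom V where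
  obj S := ⟨subAction X.obj (orbits (S : Set X.obj.V)) (isStable_orbits _),
    isNominal_subAction X.property _ _⟩
  map {_ T} h := ObjectProperty.homMk
    { hom := ↾(fun x : orbits _ => (⟨x.1, by
        obtain ⟨π, s, hs, e⟩ := x.2
        exact ⟨π, s, leOfHom h hs, e⟩⟩ : orbits (T : Set X.obj.V)))
      comm := fun _ => rfl }

/-- A nominal set as a cocone over its finitely generated subsets. -/
def finiteOrbitsCocone (X : Nom V) : Cocone (finiteOrbits X) where
  pt := X
  ι :=
    { app := fun _ => ObjectProperty.homMk (subActionι X.obj _ (isStable_orbits _))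
      naturality := fun _ _ _ => rfl }

lemma nonempty_isColimit_finiteOrbitsCocone (X : Nom V) :
    Nonempty (IsColimit (finiteOrbitsCocone X)) := by
  classical
  refine ⟨isColimitOfReflects (nomForget V)
    (Types.FilteredColimit.isColimitOf' _ _ (fun x => ?_) (fun S _ _ h => ?_))⟩
  · exact ⟨{x}, ⟨x, subset_orbits _ (Finset.mem_coe.2 (Finset.mem_singleton_self x))⟩, rfl⟩
  · exact ⟨S, 𝟙 S, congrArg _ (Subtype.ext h)⟩

/-- The identity factors through one of the orbit-finite subsets of which `X` is the filtered
colimit. -/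
lemma isFinitelyGenerated_of_isFinitelyPresentable (X : Nom V)
    (hX : IsFinitelyPresentable.{u} X) : IsFinitelyGenerated X.obj := by
  classical
  obtain ⟨hc⟩ := nonempty_isColimit_finiteOrbitsCocone X
  obtain ⟨S, p, hp⟩ := IsFinitelyPresentable.exists_hom_of_isColimit hc (𝟙 X)
  refine ⟨S, S.finite_toSet, fun x => ?_⟩
  have h1 : (p.hom.hom x).1 = x :=
    (ConcreteCategory.congr_hom (congrArg (fun k : X ⟶ X => k.hom.hom) hp) x :)
  have h2 := (p.hom.hom x).2
  rw [h1] at h2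
  exact h2

end FinitelyGenerated

/-! ### The rational fixpoint of the lifting -/

section NomCoalgebra

variable {V : Type u} {F : Type u ⥤ Type u} {lam : PermLaw V F} {hnom : lam.NomRestricting}

lemma isFinitelyPresentable_nom_iff (X : Nom V) :
    IsFinitelyPresentable.{u} X ↔ IsFinitelyGenerated X.obj :=
  ⟨isFinitelyGenerated_of_isFinitelyPresentable X, isFinitelyPresentable_of_isFinitelyGenerated X⟩

lemma fpCoalgebra_nom_iff (C : Endofunctor.Coalgebra (lam.nomLift hnom)) :
    fpCoalgebra (lam.nomLift hnom) C ↔ IsFinitelyGenerated C.V.obj :=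
  isFinitelyPresentable_nom_iff C.V

instance : (underlying lam hnom).Faithful where
  map_injective h := by
    apply Endofunctor.Coalgebra.ext
    apply (isNominal V).hom_ext
    apply Action.Hom.ext
    exact congrArg Endofunctor.Coalgebra.Hom.f h

/-- An equivariant homomorphism of the underlying coalgebras. -/
def nomHomMk {A B : Endofunctor.Coalgebra (lam.nomLift hnom)}
    (f : (underlying lam hnom).obj A ⟶ (underlying lam hnom).obj B)
    (h : ∀ (π : FinPerm V) (x : A.V.obj.V), f.f (A.V.obj.ρ π x) = B.V.obj.ρ π (f.f x)) : A ⟶ B where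
  f := ObjectProperty.homMk
    { hom := f.f
      comm := fun π => ConcreteCategory.hom_ext _ _ (h π) }
  h := by
    apply (isNominal V).hom_ext
    apply Action.Hom.ext
    exact f.h

lemma nomHom_ρ {A B : Endofunctor.Coalgebra (lam.nomLift hnom)} (f : A ⟶ B) (π : FinPerm V)
    (x : A.V.obj.V) : ((underlying lam hnom).map f).f (A.V.obj.ρ π x) =
      B.V.obj.ρ π (((underlying lam hnom).map f).f x) :=
  hom_ρ f.f.hom π x

variable [F.PreservesMonomorphisms]

/-- The subcoalgebra carried by a closed and stable subset. -/
noncomputable def nomSubcoalgebra (C : Endofunctor.Coalgebra (lam.nomLift hnom))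
    (I : Set C.V.obj.V) (hI : IsStable I) (hc : IsClosedUnder ((underlying lam hnom).obj C) I) :
    Endofunctor.Coalgebra (lam.nomLift hnom) where
  V := ⟨subAction C.V.obj I hI, isNominal_subAction C.V.property I hI⟩
  str := ObjectProperty.homMk
    { hom := (subcoalgebra ((underlying lam hnom).obj C) I hc).str
      comm := fun π => by
        ext x
        -- Equivariance can be tested after the injective map `F.map (incl I)`, where it becomes
        -- that of the structure of `C`.
        apply map_injective F (incl I) Subtype.val_injective
        have h1 := str_apply (subcoalgebraι ((underlying lam hnom).obj C) I hc)
        refine (h1 _).symm.trans ?_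
        refine (hom_ρ C.str.hom π x.1).trans ?_
        refine Eq.trans ?_ (lam.liftAct_natural (subActionι C.V.obj I hI) π _).symm
        exact congrArg (lam.liftAct C.V.obj π) (h1 x) }

/-- The inclusion of a subcoalgebra. -/
noncomputable def nomSubcoalgebraι (C : Endofunctor.Coalgebra (lam.nomLift hnom))
    (I : Set C.V.obj.V) (hI : IsStable I) (hc : IsClosedUnder ((underlying lam hnom).obj C) I) :
    nomSubcoalgebra C I hI hc ⟶ C :=
  nomHomMk (subcoalgebraι ((underlying lam hnom).obj C) I hc) (fun _ _ => rfl)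

/-- A homomorphism with values in a closed and stable subset factors through the subcoalgebra. -/
noncomputable def nomSubcoalgebraLift {A C : Endofunctor.Coalgebra (lam.nomLift hnom)}
    {I : Set C.V.obj.V} (hI : IsStable I) (hc : IsClosedUnder ((underlying lam hnom).obj C) I)
    (f : A ⟶ C) (hf : ∀ x, ((underlying lam hnom).map f).f x ∈ I) :
    A ⟶ nomSubcoalgebra C I hI hc :=
  nomHomMk (subcoalgebraLift hc ((underlying lam hnom).map f) hf)
    (fun π x => Subtype.ext (nomHom_ρ f π x))

lemma nomSubcoalgebraLift_ι {A C : Endofunctor.Coalgebra (lam.nomLift hnom)}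
    {I : Set C.V.obj.V} (hI : IsStable I) (hc : IsClosedUnder ((underlying lam hnom).obj C) I)
    (f : A ⟶ C) (hf : ∀ x, ((underlying lam hnom).map f).f x ∈ I) :
    nomSubcoalgebraLift hI hc f hf ≫ nomSubcoalgebraι C I hI hc = f := rfl

lemma isFinitelyGenerated_subAction_union_range {A B C : PermSet V} (f : A ⟶ C) (g : B ⟶ C)
    (hA : IsFinitelyGenerated A) (hB : IsFinitelyGenerated B)
    (hI : IsStable (Set.range f.hom ∪ Set.range g.hom)) :
    IsFinitelyGenerated (subAction C (Set.range f.hom ∪ Set.range g.hom) hI) := by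
  obtain ⟨S, hS, hgS⟩ := hA
  obtain ⟨T, hT, hgT⟩ := hB
  let i : A.V → (Set.range f.hom ∪ Set.range g.hom : Set C.V) := fun x => ⟨f.hom x, Or.inl ⟨x, rfl⟩⟩
  let j : B.V → (Set.range f.hom ∪ Set.range g.hom : Set C.V) := fun x => ⟨g.hom x, Or.inr ⟨x, rfl⟩⟩
  refine ⟨i '' S ∪ j '' T, (hS.image i).union (hT.image j), ?_⟩
  rintro ⟨_, ⟨x, rfl⟩ | ⟨x, rfl⟩⟩
  · obtain ⟨π, s, hs, rfl⟩ := hgS x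
    exact ⟨π, i s, Or.inl ⟨s, hs, rfl⟩, Subtype.ext (hom_ρ f π s).symm⟩
  · obtain ⟨π, s, hs, rfl⟩ := hgT x
    exact ⟨π, j s, Or.inr ⟨s, hs, rfl⟩, Subtype.ext (hom_ρ g π s).symm⟩

/-- A coalgebra for the lifting is locally finitely generated if it is covered by homomorphisms
from finitely generated coalgebras. -/
def LocallyFinitelyGenerated (L : Endofunctor.Coalgebra (lam.nomLift hnom)) : Prop :=
  ∀ x : L.V.obj.V, ∃ (C : Endofunctor.Coalgebra (lam.nomLift hnom))
    (_ : IsFinitelyGenerated C.V.obj) (f : C ⟶ L), x ∈ Set.range ((underlying lam hnom).map f).f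

lemma LocallyFinitelyGenerated.isCovered {L : Endofunctor.Coalgebra (lam.nomLift hnom)}
    (hL : LocallyFinitelyGenerated L) :
    IsCovered (fpCoalgebra (lam.nomLift hnom))
      (underlying lam hnom ⋙ Endofunctor.Coalgebra.forget F) L where
  cover x := by
    obtain ⟨C, hC, f, hf⟩ := hL x
    exact ⟨C, (fpCoalgebra_nom_iff C).2 hC, f, hf⟩
  directed {C C'} hC hC' f f' := by
    rw [fpCoalgebra_nom_iff] at hC hC'
    let I : Set L.V.obj.V := Set.range f.f.hom.hom ∪ Set.range f'.f.hom.hom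
    have hI : IsStable I := by
      rintro π _ (⟨x, rfl⟩ | ⟨x, rfl⟩)
      · exact Or.inl ⟨C.V.obj.ρ π x, hom_ρ f.f.hom π x⟩
      · exact Or.inr ⟨C'.V.obj.ρ π x, hom_ρ f'.f.hom π x⟩
    have hc : IsClosedUnder ((underlying lam hnom).obj L) I := by
      refine isClosedUnder_of_cover ?_
      rintro x (hx | hx)
      · exact ⟨_, (underlying lam hnom).map f, hx, Set.subset_union_left⟩
      · exact ⟨_, (underlying lam hnom).map f', hx, Set.subset_union_right⟩
    exact ⟨nomSubcoalgebra L I hI hc,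
      (fpCoalgebra_nom_iff _).2
        (isFinitelyGenerated_subAction_union_range f.f.hom f'.f.hom hC hC' hI),
      nomSubcoalgebraι L I hI hc,
      nomSubcoalgebraLift hI hc f (fun x => Or.inl ⟨x, rfl⟩),
      nomSubcoalgebraLift hI hc f' (fun x => Or.inr ⟨x, rfl⟩), Subtype.val_injective,
      nomSubcoalgebraLift_ι _ _ _ _, nomSubcoalgebraLift_ι _ _ _ _⟩
  glue {E} h hh := by
    let h' : ((underlying lam hnom).obj L).V ⟶ ((underlying lam hnom).obj E).V := h
    have key : ∀ x : L.V.obj.V, ∃ (C : Endofunctor.Coalgebra (lam.nomLift hnom)) (f : C ⟶ L)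
        (k : C ⟶ E) (y : C.V.obj.V), ((underlying lam hnom).map f).f y = x ∧
          ((underlying lam hnom).map f).f ≫ h' = ((underlying lam hnom).map k).f := by
      intro x
      obtain ⟨C, hC, f, y, hy⟩ := hL x
      obtain ⟨k, hk⟩ := hh ((fpCoalgebra_nom_iff C).2 hC) f
      exact ⟨C, f, k, y, hy, hk⟩
    refine ⟨nomHomMk (coalgebraHomMk h' fun x => ?_) fun π x => ?_, rfl⟩
    · obtain ⟨C, f, k, y, rfl, hk⟩ := key x
      have h1 := str_apply ((underlying lam hnom).map k) y
      rw [← hk, map_apply_comp] at h1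
      exact h1.trans (congrArg (F.map h') (str_apply ((underlying lam hnom).map f) y).symm)
    · obtain ⟨C, f, k, y, rfl, hk⟩ := key x
      change h' (L.V.obj.ρ π _) = E.V.obj.ρ π (h' _)
      have hk' : ∀ y, h' (((underlying lam hnom).map f).f y) =
          ((underlying lam hnom).map k).f y := fun y => ConcreteCategory.congr_hom hk y
      exact (congrArg h' (nomHom_ρ f π y).symm).trans ((hk' _).trans
        ((nomHom_ρ k π y).trans (congrArg (E.V.obj.ρ π) (hk' y).symm)))

variable [PreservesFilteredColimits F]

/-- What remains is a cover of `R` by orbit-finite subcoalgebras and a unique equivariant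
homomorphism from each orbit-finite coalgebra. -/
lemma isRationalFixpoint_liftCoalgebra (hloc : lam.Localizable) {R : Endofunctor.Coalgebra F}
    (hR : IsRationalFixpoint F R) (a : lam.prodCoalgebra R ⟶ R) (ρ : FinPerm V →* End R.V)
    (hρ : ∀ (π : FinPerm V) (x : R.V), ρ π x = a.f (π, x))
    (hsupp : isNominal V (Action.mk R.V ρ))
    (hequiv : ∀ π : FinPerm V,
      ρ π ≫ R.str = R.str ≫ (lam.permLift.obj (Action.mk R.V ρ)).ρ π) :
    IsRationalFixpoint (lam.nomLift hnom) (lam.liftCoalgebra hnom R ρ hsupp hequiv) := by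
  let X : PermSet V := Action.mk R.V ρ
  let N := lam.liftCoalgebra hnom R ρ hsupp hequiv
  have hcov : LocallyFinitelyGenerated N := by
    intro x
    obtain ⟨C, hC, f, y, rfl⟩ := hR.locallyFinite x
    let S : Set X.V := Set.range f.f
    have hc : IsClosedUnder ((underlying lam hnom).obj N) (orbits S) := by
      rintro _ ⟨π, _, ⟨z, rfl⟩, rfl⟩
      -- The structure at `f z` comes from `t` over the orbits; by equivariance, the structure at
      -- its translate by `π` comes from the translate of `t`.
      obtain ⟨t, ht⟩ := range_map_mono F (subset_orbits S) ⟨C.str z, (str_apply f z).symm⟩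
      refine ⟨lam.liftAct (subAction X (orbits S) (isStable_orbits S)) π t, ?_⟩
      refine (lam.liftAct_natural (subActionι X (orbits S) (isStable_orbits S)) π t).trans ?_
      refine Eq.trans ?_ (ConcreteCategory.congr_hom (hequiv π) (f.f z)).symm
      exact congrArg (lam.liftAct X π) ht
    exact ⟨nomSubcoalgebra N (orbits S) (isStable_orbits S) hc,
      isFinitelyGenerated_orbits (Set.finite_range f.f),
      nomSubcoalgebraι N (orbits S) (isStable_orbits S) hc,
      ⟨_, subset_orbits S ⟨y, rfl⟩⟩, rfl⟩
  refine hcov.isCovered.exists_isColimit fun {C} hC => ?_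
  have hlf : LocallyFinite ((underlying lam hnom).obj C) :=
    ((fpCoalgebra_nom_iff C).1 hC).locallyFinite hloc
  obtain ⟨k, -, hk⟩ := hR.existsUnique_hom hlf
  -- Evaluated at `(π, x)`, this is the equivariance of `k`.
  have e : actHom C ≫ k = prodMap lam k ≫ a :=
    (hR.existsUnique_hom (hlf.prodCoalgebra hloc)).unique trivial trivial
  refine ⟨nomHomMk (B := N) k fun π x => ?_, trivial, fun k' _ => ?_⟩
  · exact (hom_congr e (π, x)).trans (hρ π (k.f x)).symm
  · exact (underlying lam hnom).map_injective (hk ((underlying lam hnom).map k') trivial)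

end NomCoalgebra

end NominalLifting

theorem mainTheorem1 {V : Type u} (F : Type u ⥤ Type u) [PreservesFilteredColimits F]
    [F.PreservesMonomorphisms] (lam : NominalLifting.PermLaw V F) (hloc : lam.Localizable)
    (hnom : lam.NomRestricting) :
    PreservesFilteredColimits (lam.nomLift hnom) ∧
    (∃ R : Endofunctor.Coalgebra F, NominalLifting.IsRationalFixpoint F R) ∧
    ∀ R : Endofunctor.Coalgebra F, NominalLifting.IsRationalFixpoint F R →
      ∃ a : lam.prodCoalgebra R ⟶ R, (∀ b : lam.prodCoalgebra R ⟶ R, b = a) ∧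
        ∃ ρ : NominalLifting.FinPerm V →* End R.V,
          (∀ (π : NominalLifting.FinPerm V) (x : R.V), ρ π x = a.f (π, x)) ∧
          ∃ (hsupp : NominalLifting.isNominal V (Action.mk R.V ρ))
            (hequiv : ∀ π : NominalLifting.FinPerm V,
              ρ π ≫ R.str = R.str ≫ (lam.permLift.obj (Action.mk R.V ρ)).ρ π),
            NominalLifting.IsRationalFixpoint (lam.nomLift hnom)
              (lam.liftCoalgebra hnom R ρ hsupp hequiv) := by
  refine ⟨NominalLifting.preservesFilteredColimits_nomLift hnom,
    NominalLifting.exists_isRationalFixpoint F, fun R hR => ?_⟩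
  obtain ⟨a, -, ha⟩ := hR.existsUnique_hom (hR.locallyFinite.prodCoalgebra hloc)
  let ρ : NominalLifting.FinPerm V →* End R.V :=
    { toFun := fun π => ↾(fun x => a.f (π, x))
      map_one' := ConcreteCategory.hom_ext _ _ (NominalLifting.action_one hR a)
      map_mul' := fun π σ => ConcreteCategory.hom_ext _ _
        (NominalLifting.action_mul hR a hloc π σ) }
  have hρ : ∀ (π : NominalLifting.FinPerm V) (x : R.V), ρ π x = a.f (π, x) := fun _ _ => rfl
  have hsupp : NominalLifting.isNominal V (Action.mk R.V ρ) :=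
    NominalLifting.action_finitely_supported hR a hloc hnom
  have hequiv : ∀ π : NominalLifting.FinPerm V,
      ρ π ≫ R.str = R.str ≫ (lam.permLift.obj (Action.mk R.V ρ)).ρ π := fun π =>
    -- Equivariance of the structure map is the homomorphism square of `a`, read at `(π, x)`.
    ConcreteCategory.hom_ext _ _ fun x => NominalLifting.str_apply a (π, x)
  exact ⟨a, fun b => ha b trivial, ρ, hρ, hsupp, hequiv,
    NominalLifting.isRationalFixpoint_liftCoalgebra hloc hR a ρ hρ hsupp hequiv⟩
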